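/- Let $\mathcal X$ be a finite alphabet, $P_0,P_1$ probability mass functions on $\mathcal X$, $\varepsilon>0$. For $\tau>0$ let $S_\tau=\{x: P_0(x)\ge \tau P_1(x)\}$. The binary mechanism $W_\tau$ maps $x$ to the bit $v=0$ if $x\in S_\tau$ and $v=1$ otherwise, and then outputs $y=v$ with probability $\frac{e^\varepsilon}{e^\varepsilon+1}$ and $y=1-v$ with probability $\frac1{e^\varepsilon+1}$. Let $Q_j^\tau(y)=\sum_x P_j(x)W_\tau(y|x)$, $j=0,1$, and let $\tau^*>0$ maximize over $\tau>0$ the Chernoff information $$I_{ch}(Q_0^\tau,Q_1^\tau)=-\min_{\lambda\in(0,1)}\log\sum_{y\in\{0,1\}}Q_0^\tau(y)^\lambda Q_1^\tau(y)^{1-\lambda}.$$ Let $n>1$ and $k^\star\in(1,n]$. Let $x_1,\dots,x_n$ be independent, with $x_i\sim P_0$ for $i<k^\star$ and $x_i\sim P_1$ for $i\ge k^\star$. The offline BM-CPD algorithm passes each $x_i$ independently through $W_{\tau^*}$ to get $y_i$, and outputs $$\hat k\in\arg\max_{k\in\{1,\dots,n\}}\ \sum_{i=k}^n\log\frac{Q_1^{\tau^*}(y_i)}{Q_0^{\tau^*}(y_i)}$$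 (ties broken arbitrarily). **Theorem.** The mechanism $W_{\tau^*}$ applied to each data point is $\varepsilon$-locally differentially private, i.e. $W_{\tau^*}(T|x)\le e^\varepsilon W_{\tau^*}(T|x')$ for all $x,x'\in\mathcal X$ and $T\subseteq\{0,1\}$. For every integer $\alpha$ with $1\le\alpha\le n$, the error probability $\beta_b=\mathbb P\{\hat k\notin[k^\star-\alpha,k^\star+\alpha]\}$ satisfies $$\beta_b\le 2\min\Big\{\sum_{i=1}^{i^*}\exp\Big(\frac{-2^{i-1}\alpha\,\tilde C_b^2}{s_b^2}\Big)\,;\ \Big(1-\frac{C_b}{2}\Big)^{\alpha/2}\Big\},\qquad i^*=\Big\lceil\log_2\frac{n-1}{\alpha}\Big\rceil,$$ where the sum is empty if $i^*\le 0$, and $$s_b=\min\{2\varepsilon,\ \tanh(\varepsilon/2)\,s\},\qquad C_b=2\tanh^2(\varepsilon/2)\,d_{TV}^2(P_0,P_1),\qquad \tilde C_b=2\tanh^2(\varepsilon/2)\Big(\sum_{x\in S_{\tau^*}}|P_0(x)-P_1(x)|\Big)^2.$$ Here $d_{TV}(P_0,P_1)=\frac12\sum_x|P_0(x)-P_1(x)|$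 and $s=D_\infty(P_1\|P_0)+D_\infty(P_0\|P_1)\in[0,\infty]$, where $D_\infty(P\|Q)=\log\max_{x:P(x)>0}\frac{P(x)}{Q(x)}$ (equal to $+\infty$ if some $x$ has $P(x)>0=Q(x)$); if $P_0$ and $P_1$ have no zeros, then $s=\max_x\log\frac{P_1(x)}{P_0(x)}-\min_x\log\frac{P_1(x)}{P_0(x)}$. If $P_0=P_1$, where $\tilde C_b=s_b=0$, the quotient $\tilde C_b^2/s_b^2$ is read as $0$. -/

import Mathlib

open MeasureTheory ProbabilityTheory

noncomputable section

namespace BMCPD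

/-- The Chernoff information `-min_{λ ∈ (0,1)} log ∑ P₀^λ P₁^(1-λ)` of two probability mass
functions on a finite alphabet. It is only used below for mass functions without zeros. -/
def chernoffInfo {A : Type*} [Fintype A] (P₀ P₁ : A → ℝ) : ℝ :=
  -⨅ lam : Set.Ioo (0 : ℝ) 1,
    Real.log (∑ a, P₀ a ^ (lam : ℝ) * P₁ a ^ (1 - (lam : ℝ)))

/-- The total variation distance of two probability mass functions. -/
def dTV {A : Type*} [Fintype A] (P₀ P₁ : A → ℝ) : ℝ :=
  (1 / 2) * ∑ a, |P₀ a - P₁ a|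

/-- The Rényi divergence of order infinity `log max_a P(a)/Q(a)`, with values in `[0, ∞]` on
probability mass functions. Letters with `P a = 0` do not contribute, and the value is `⊤`
if some letter has `P a > 0` and `Q a = 0`. -/
def renyiInf {A : Type*} (P Q : A → ℝ) : EReal :=
  ENNReal.log (⨆ a, ENNReal.ofReal (P a) / ENNReal.ofReal (Q a))

/-- The sensitivity `s = D_∞(P₁‖P₀) + D_∞(P₀‖P₁)` of the log-likelihood ratio statistic,
which is `max log (P₁/P₀) - min log (P₁/P₀)` if `P₀` and `P₁` have no zeros. -/
def sensitivity {A : Type*} (P₀ P₁ : A → ℝ) : EReal :=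
  renyiInf P₁ P₀ + renyiInf P₀ P₁

/-- A channel `W(y|x)`, written `W x y`, that is `ε`-locally differentially private. -/
structure IsLDP {A B : Type*} [Fintype B] (ε : ℝ) (W : A → B → ℝ) : Prop where
  nonneg : ∀ x y, 0 ≤ W x y
  sum_eq_one : ∀ x, ∑ y, W x y = 1
  ldp : ∀ x x' : A, ∀ S : Finset B, ∑ y ∈ S, W x y ≤ Real.exp ε * ∑ y ∈ S, W x' y

/-- The distribution `Q(y) = ∑ₓ P(x) W(y|x)` that a channel induces from `P`. -/
def induced {A B : Type*} [Fintype A] (P : A → ℝ) (W : A → B → ℝ) (y : B) : ℝ :=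
  ∑ x, P x * W x y

open Classical in
/-- The set `S_τ = {x : P₀(x) ≥ τ P₁(x)}`. -/
def likelihoodSet {A : Type*} [Fintype A] (P₀ P₁ : A → ℝ) (τ : ℝ) : Finset A :=
  {x | P₀ x ≥ τ * P₁ x}

open Classical in
/-- The quantizer `Z_τ`: bit `0` on `S_τ`, bit `1` on the complement. -/
def quantizer {A : Type*} [Fintype A] (P₀ P₁ : A → ℝ) (τ : ℝ) (x : A) : Fin 2 :=
  if x ∈ likelihoodSet P₀ P₁ τ then 0 else 1

/-- Binary randomized response `W(y|v)`. -/
def binaryRR (ε : ℝ) (v y : Fin 2) : ℝ :=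
  if y = v then Real.exp ε / (Real.exp ε + 1) else 1 / (Real.exp ε + 1)

/-- The binary mechanism: quantization by `Z_τ`, then binary randomized response. -/
def binaryMechanism {A : Type*} [Fintype A] (ε : ℝ) (P₀ P₁ : A → ℝ) (τ : ℝ)
    (x : A) (y : Fin 2) : ℝ :=
  ∑ v, (if quantizer P₀ P₁ τ x = v then 1 else 0) * binaryRR ε v y

/-- `Q₀^τ`, `Q₁^τ`: the law that the binary mechanism with threshold `τ`
induces from `P` (to be applied with `P = P₀` and `P = P₁`). -/
def inducedBM {A : Type*} [Fintype A] (ε : ℝ) (P₀ P₁ : A → ℝ) (τ : ℝ) (P : A → ℝ) :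
    Fin 2 → ℝ :=
  induced P (binaryMechanism ε P₀ P₁ τ)

/-- `τ` maximizes, over all positive thresholds, the Chernoff information of the two
distributions induced by the binary mechanism. -/
def IsOptimalThreshold {A : Type*} [Fintype A] (ε : ℝ) (P₀ P₁ : A → ℝ) (τ : ℝ) : Prop :=
  0 < τ ∧ ∀ τ' : ℝ, 0 < τ' →
    chernoffInfo (inducedBM ε P₀ P₁ τ' P₀) (inducedBM ε P₀ P₁ τ' P₁) ≤
      chernoffInfo (inducedBM ε P₀ P₁ τ P₀) (inducedBM ε P₀ P₁ τ P₁)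

/-- `X` is a data set of size `n` with change-point `kstar` and `Y` is its privatized version.
The entry with index `i : Fin n` is the sample number `i + 1` in `{1, …, n}`. The pairs
`(Xᵢ, Yᵢ)` are independent; samples number `1, …, kstar - 1` follow `P₀`, the later ones
follow `P₁`; and `Yᵢ` is the output of the channel `W` at the input `Xᵢ`. -/
structure IsPrivatizedSample {Ω A B : Type*} [MeasurableSpace Ω] [MeasurableSpace A]
    [MeasurableSpace B] {n : ℕ} (μ : Measure Ω) (P₀ P₁ : A → ℝ) (W : A → B → ℝ) (kstar : ℕ)
    (X : Fin n → Ω → A) (Y : Fin n → Ω → B) : Prop where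
  measurable_X : ∀ i, Measurable (X i)
  measurable_Y : ∀ i, Measurable (Y i)
  indep : iIndepFun (fun i ω => (X i ω, Y i ω)) μ
  law : ∀ i x y, μ.real {ω | X i ω = x ∧ Y i ω = y} =
    (if (i : ℕ) + 1 < kstar then P₀ x else P₁ x) * W x y

/-- The log-likelihood ratio `l(y, k) = ∑_{i=k}^n log (Q₁(yᵢ)/Q₀(yᵢ))`. -/
def logLR {B : Type*} {n : ℕ} (Q₀ Q₁ : B → ℝ) (y : Fin n → B) (k : ℕ) : ℝ :=
  ∑ i : Fin n, if k ≤ (i : ℕ) + 1 then Real.log (Q₁ (y i) / Q₀ (y i)) else 0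

/-- `k` is a maximizer of `l(y, ·)` over `{1, …, n}`. -/
def IsGLRTEstimate {B : Type*} {n : ℕ} (Q₀ Q₁ : B → ℝ) (y : Fin n → B) (k : ℕ) : Prop :=
  k ∈ Finset.Icc 1 n ∧ ∀ k' ∈ Finset.Icc 1 n, logLR Q₀ Q₁ y k' ≤ logLR Q₀ Q₁ y k

/-- `khat` is an output of the private change-point algorithm: the threshold `τ` is optimal,
`Y` is the data set `X` after the binary mechanism with threshold `τ`, and `khat` maximizes the
log-likelihood ratio statistic of `Y`. Ties may be broken in any way. -/
structure IsOfflineBMCPD {Ω A : Type*} [Fintype A] [MeasurableSpace Ω] [MeasurableSpace A]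
    {n : ℕ} (μ : Measure Ω) (ε : ℝ) (P₀ P₁ : A → ℝ) (kstar : ℕ) (τ : ℝ)
    (X : Fin n → Ω → A) (Y : Fin n → Ω → Fin 2) (khat : Ω → ℕ) : Prop where
  optimal : IsOptimalThreshold ε P₀ P₁ τ
  sample : IsPrivatizedSample μ P₀ P₁ (binaryMechanism ε P₀ P₁ τ) kstar X Y
  measurable_khat : Measurable khat
  estimate : ∀ ω, IsGLRTEstimate (inducedBM ε P₀ P₁ τ P₀) (inducedBM ε P₀ P₁ τ P₁)
    (fun i => Y i ω) (khat ω)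

/-- `(α, β)`-accuracy: the estimate misses `[kstar - α, kstar + α]` with probability `β`. -/
def IsAccurate {Ω : Type*} [MeasurableSpace Ω] (μ : Measure Ω) (kstar : ℕ) (khat : Ω → ℕ)
    (α : ℕ) (β : ℝ) : Prop :=
  μ.real {ω | (khat ω : ℤ) ∉ Set.Icc ((kstar : ℤ) - α) ((kstar : ℤ) + α)} = β

/-- `s_b = min {2ε, tanh(ε/2) s}`; a real number even if `s = ⊤`. -/
def sB {A : Type*} (ε : ℝ) (P₀ P₁ : A → ℝ) : ℝ :=
  (min ((2 * ε : ℝ) : EReal) ((Real.tanh (ε / 2) : EReal) * sensitivity P₀ P₁)).toReal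

/-- `C_b = 2 tanh²(ε/2) d_TV²(P₀, P₁)`. -/
def cB {A : Type*} [Fintype A] (ε : ℝ) (P₀ P₁ : A → ℝ) : ℝ :=
  2 * Real.tanh (ε / 2) ^ 2 * dTV P₀ P₁ ^ 2

/-- `C̃_b = 2 tanh²(ε/2) (∑_{x ∈ S_τ} |P₀(x) - P₁(x)|)²`. -/
def cTildeB {A : Type*} [Fintype A] (ε : ℝ) (P₀ P₁ : A → ℝ) (τ : ℝ) : ℝ :=
  2 * Real.tanh (ε / 2) ^ 2 * (∑ x ∈ likelihoodSet P₀ P₁ τ, |P₀ x - P₁ x|) ^ 2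

/-- `i* = ⌈log₂((n-1)/α)⌉`, replaced by `0` if it is negative (the sum over `1 ≤ i ≤ i*` is then
empty in either case). -/
def iStar (n α : ℕ) : ℕ :=
  ⌈Real.logb 2 (((n : ℝ) - 1) / α)⌉₊

end BMCPD

end

namespace BMCPD

open Real Set

/-! Write `t = tanh (ε / 2)`, `x = t * dTV P₀ P₁`, and let `I` be the Chernoff information of the
two output laws at the optimal threshold. The whole error bound reduces to `2 * exp (-(α + 1) * I)`
together with two lower bounds for `I`.

The error bound: if the estimate misses by more than `α`, a walk of log-likelihood ratios, read
backwards or forwards from the change-point, is nonnegative at some time at least `α + 1`. A maximal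
inequality for the exponential of the walk bounds each side by the Chernoff sum to the power `α +
1`, for every exponent (`measureReal_error_le_bernoulliChernoff`). No union over dyadic blocks is
needed: the first term of the stated sum already suffices.

The term with `cB`: optimality lets `I` be compared with threshold `1`, whose output laws are at
total variation distance `x`. The exponent `1/2` gives `I ≥ -log (1 - x ^ 2) / 2`
(`neg_half_log_le_chernoffInfo`).

The term with `cTildeB` needs `cTildeB ^ 2 / sB ^ 2 ≤ I`. Let `D` be the total variation distance of
the optimal output laws. Since `t * ∑ x ∈ S_τ, |P₀ x - P₁ x| ≤ 2 * x - D`, it is enough that `4 * (2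
* x - D) ^ 4 ≤ I * R ^ 2` with `R = sB` (`chernoff_mul_sq_ge`). A small `D` is the danger, so one
must show that a large `I` forces `D` or `R` to be large. In natural parameters `I` is a supremum of
Jensen gaps of `logPartition`. If both parameters have the same sign, the sigmoid is convex or
concave between them and the gap is at most `4/27 * D * R`. If the signs differ, the gap is at most
an eighth of the squared parameter distance times `λ (1 - λ)`, so the parameters are far apart, and
then `D` is bounded below through `tanh`. -/

lemma convexOn_mul_add_mul_le {D : Set ℝ} {g : ℝ → ℝ} (hg : ConvexOn ℝ D g) {x y p q : ℝ}
    (hx : x ∈ D) (hy : y ∈ D) (hp : 0 ≤ p) (hq : 0 ≤ q) (hpq : p + q = 1) :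
    g (p * x + q * y) ≤ p * g x + q * g y :=
  hg.2 hx hy hp hq hpq

/-! ### Jensen gaps of functions with convex derivative -/

/-- A monotone convex function stays, left of `a`, above the positive part of the extension of its
chord over `[a, 1]`; this gives the lower bound below on the increment of an antiderivative. -/
lemma increment_ge_of_convex_deriv {B g : ℝ → ℝ} (hB : ∀ s, HasDerivAt B (g s) s)
    (hg : ConvexOn ℝ (Icc 0 1) g) (hg0 : ∀ s ∈ Icc (0 : ℝ) 1, 0 ≤ g s) (h0 : g 0 = 0)
    (h1 : g 1 = 1) {a : ℝ} (ha : a ∈ Ioo (0 : ℝ) 1) :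
    g a ^ 2 * (1 - a) ≤ 2 * (1 - g a) * (B a - B 0) := by
  obtain ⟨ha0, ha1⟩ := ha
  have hy0 : 0 ≤ g a := hg0 a ⟨ha0.le, ha1.le⟩
  have hya : g a ≤ a := by
    have := convexOn_mul_add_mul_le hg (x := 0) (y := 1) (by simp) (by simp) (p := 1 - a) (q := a) (by linarith)
      ha0.le (by ring)
    simpa [h0, h1] using this
  set y := g a with hy
  have hy1 : y < 1 := by linarith
  set m := (1 - y) / (1 - a) with hm
  have hm0 : 0 < m := div_pos (by linarith) (by linarith)
  have hma : m * (1 - a) = 1 - y := by rw [hm]; field_simp [(by linarith : (1 : ℝ) - a ≠ 0)]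
  set l := y / m with hl
  have hlm : l * m = y := by rw [hl]; field_simp
  have hl0 : 0 ≤ l := by positivity
  have hla : l ≤ a := by
    rw [hl, div_le_iff₀ hm0]
    nlinarith
  have hline : ∀ s ∈ Icc (0 : ℝ) a, y - m * (a - s) ≤ g s := by
    intro s hs
    have h1s : 0 < 1 - s := by linarith [hs.2]
    have := convexOn_mul_add_mul_le hg (x := s) (y := 1) ⟨hs.1, by linarith [hs.2]⟩ (by simp)
      (p := (1 - a) / (1 - s)) (q := (a - s) / (1 - s)) (by apply div_nonneg <;> linarith)
      (div_nonneg (by linarith [hs.2]) h1s.le) (by field_simp; ring)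
    have hpt : ((1 - a) / (1 - s)) * s + ((a - s) / (1 - s)) * (1 : ℝ) = a := by
      field_simp; ring
    rw [hpt, h1] at this
    simp only [mul_one, ← hy] at this
    have h3 : y * (1 - s) ≤ (1 - a) * g s + (a - s) := by
      have := mul_le_mul_of_nonneg_right this h1s.le
      have e : ((1 - a) / (1 - s) * g s + (a - s) / (1 - s)) * (1 - s) =
        (1 - a) * g s + (a - s) := by field_simp
      linarith
    have h4 : (1 - a) * (y - m * (a - s)) ≤ (1 - a) * g s := by nlinarith
    exact le_of_mul_le_mul_left h4 (by linarith)
  have hmono : MonotoneOn B (Icc 0 a) := by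
    apply monotoneOn_of_deriv_nonneg (convex_Icc 0 a)
    · exact fun s _ => (hB s).continuousAt.continuousWithinAt
    · exact fun s _ => (hB s).differentiableAt.differentiableWithinAt
    · intro s hs
      rw [interior_Icc] at hs
      rw [(hB s).deriv]
      exact hg0 s ⟨hs.1.le, by linarith [hs.2]⟩
  have hmono2 : MonotoneOn (fun s => B s - (y * s + m * (a - s) ^ 2 / 2)) (Icc (0 : ℝ) a) := by
    have hd : ∀ s, HasDerivAt (fun s => B s - (y * s + m * (a - s) ^ 2 / 2))
        (g s - (y - m * (a - s))) s := by
      intro s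
      have h2 : HasDerivAt (fun s : ℝ => y * s + m * (a - s) ^ 2 / 2) (y - m * (a - s)) s := by
        have := ((hasDerivAt_id s).const_mul y).add
          (((((hasDerivAt_id s).const_sub a).pow 2).const_mul m).div_const 2)
        exact this.congr_deriv (by simp; ring)
      exact (hB s).sub h2
    apply monotoneOn_of_deriv_nonneg (convex_Icc 0 a)
    · exact fun s _ => (hd s).continuousAt.continuousWithinAt
    · exact fun s _ => (hd s).differentiableAt.differentiableWithinAt
    · intro s hs
      rw [interior_Icc] at hs
      rw [(hd s).deriv]
      linarith [hline s ⟨hs.1.le, hs.2.le⟩]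
  have e1 : B 0 ≤ B (a - l) :=
    hmono (by simp [ha0.le]) ⟨by linarith, by linarith⟩ (by linarith)
  have e2 := hmono2 (a := a - l) (b := a) ⟨by linarith, by linarith⟩ (by simp [ha0.le])
    (by linarith)
  simp only [sub_self, sub_sub_cancel] at e2
  have e3 : y * l - m * l ^ 2 / 2 ≤ B a - B 0 := by nlinarith
  have e4 : y * l / 2 ≤ B a - B 0 := by
    have : m * l ^ 2 = y * l := by rw [← hlm]; ring
    linarith
  have e5 : (1 - y) * l = y * (1 - a) := by
    rw [← hma]; rw [← hlm]; ring
  have e6 := mul_le_mul_of_nonneg_left e4 (by linarith : 0 ≤ 2 * (1 - y))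
  nlinarith

/-- A convex derivative lies below its chord over `[a, 1]`, so its integral is at most the area of
the trapezoid. -/
lemma increment_le_of_convex_deriv {B g : ℝ → ℝ} (hB : ∀ s, HasDerivAt B (g s) s)
    (hg : ConvexOn ℝ (Icc 0 1) g) {a : ℝ} (ha : a ∈ Ioo (0 : ℝ) 1) :
    2 * (B 1 - B a) ≤ (1 - a) * (g a + g 1) := by
  obtain ⟨ha0, ha1⟩ := ha
  set k := (g 1 - g a) / (1 - a) with hk
  have hka : k * (1 - a) = g 1 - g a := by
    rw [hk]; field_simp [(by linarith : (1 : ℝ) - a ≠ 0)]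
  have hline : ∀ s ∈ Icc a 1, g s ≤ g a + k * (s - a) := by
    intro s hs
    have h1a : 0 < 1 - a := by linarith
    have := convexOn_mul_add_mul_le hg (x := a) (y := 1) ⟨ha0.le, ha1.le⟩ (by simp)
      (p := (1 - s) / (1 - a)) (q := (s - a) / (1 - a)) (div_nonneg (by linarith [hs.2]) h1a.le)
      (div_nonneg (by linarith [hs.1]) h1a.le) (by field_simp; ring)
    have hpt : ((1 - s) / (1 - a)) * a + ((s - a) / (1 - a)) * (1 : ℝ) = s := by
      field_simp; ring
    rw [hpt] at this
    refine this.trans (le_of_eq ?_)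
    simp only [hk]
    field_simp; ring
  have hmono : MonotoneOn (fun s => g a * s + k * (s - a) ^ 2 / 2 - B s) (Icc a 1) := by
    have hd : ∀ s, HasDerivAt (fun s => g a * s + k * (s - a) ^ 2 / 2 - B s)
        (g a + k * (s - a) - g s) s := by
      intro s
      have h2 : HasDerivAt (fun s : ℝ => g a * s + k * (s - a) ^ 2 / 2) (g a + k * (s - a)) s := by
        have := ((hasDerivAt_id s).const_mul (g a)).add
          (((((hasDerivAt_id s).sub_const a).pow 2).const_mul k).div_const 2)
        exact this.congr_deriv (by simp; ring)
      exact h2.sub (hB s)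
    apply monotoneOn_of_deriv_nonneg (convex_Icc a 1)
    · exact fun s _ => (hd s).continuousAt.continuousWithinAt
    · exact fun s _ => (hd s).differentiableAt.differentiableWithinAt
    · intro s hs
      rw [interior_Icc] at hs
      rw [(hd s).deriv]
      linarith [hline s ⟨hs.1.le, hs.2.le⟩]
  have e := hmono (a := a) (b := 1) (by simp [ha1.le]) (by simp [ha1.le]) ha1.le
  simp only [sub_self] at e
  nlinarith

/-- The Jensen gap of a function on `[0, 1]` whose derivative is convex and rises from `0` to `1`
is at most `4/27`. -/
lemma jensenGap_le_of_convex_deriv_normalized {B g : ℝ → ℝ} (hB : ∀ s, HasDerivAt B (g s) s)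
    (hg : ConvexOn ℝ (Icc 0 1) g) (hg0 : ∀ s ∈ Icc (0 : ℝ) 1, 0 ≤ g s) (h0 : g 0 = 0)
    (h1 : g 1 = 1) {a : ℝ} (ha : a ∈ Ioo (0 : ℝ) 1) :
    (1 - a) * B 0 + a * B 1 - B a ≤ 4 / 27 := by
  have hL := increment_ge_of_convex_deriv hB hg hg0 h0 h1 ha
  have hR := increment_le_of_convex_deriv hB hg ha
  obtain ⟨ha0, ha1⟩ := ha
  have hya : g a ≤ a := by
    have := convexOn_mul_add_mul_le hg (x := 0) (y := 1) (by simp) (by simp) (p := 1 - a) (q := a) (by linarith)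
      ha0.le (by ring)
    simpa [h0, h1] using this
  have hy0 : 0 ≤ g a := hg0 a ⟨ha0.le, ha1.le⟩
  rw [h1] at hR
  set y := g a
  obtain ⟨w, hw0, hw⟩ : ∃ w : ℝ, 0 < w ∧ w ^ 2 = 1 - a :=
    ⟨√(1 - a), sqrt_pos.2 (by linarith), sq_sqrt (by linarith)⟩
  have ea : a = 1 - w ^ 2 := by linarith
  have hw1 : w ≤ 1 := by nlinarith
  have hy1 : 0 < 1 - y := by linarith
  -- the gap is at most `w ^ 2 * (1 - w)`
  have h1' : a * (2 * (B 1 - B a)) ≤ a * (w ^ 2 * (y + 1)) := by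
    rw [hw]; exact mul_le_mul_of_nonneg_left hR ha0.le
  have key : 2 * (1 - y) * ((1 - a) * B 0 + a * B 1 - B a) ≤
      2 * (1 - y) * (w ^ 2 * (1 - w)) := by
    have h2 := mul_le_mul_of_nonneg_left h1' hy1.le
    have h3 := mul_le_mul_of_nonneg_left hL (by linarith : 0 ≤ 1 - a)
    have e : 2 * (1 - y) * ((1 - a) * B 0 + a * B 1 - B a) =
      (1 - y) * (a * (2 * (B 1 - B a))) - (1 - a) * (2 * (1 - y) * (B a - B 0)) := by ring
    rw [e]
    have h4 : (1 - y) * (a * (w ^ 2 * (y + 1))) - (1 - a) * (y ^ 2 * (1 - a)) ≤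
        2 * (1 - y) * (w ^ 2 * (1 - w)) := by
      rw [ea]
      -- This square is exactly the difference of the two sides, so the bound is the worst case over
      -- the value `y` of the derivative at `a`.
      have : 0 ≤ w ^ 2 * (w - (1 - y)) ^ 2 := by positivity
      nlinarith
    linarith
  have hgap := le_of_mul_le_mul_left key (by linarith)
  -- The maximum is attained at `w = 2/3`.
  have : w ^ 2 * (1 - w) ≤ 4 / 27 := by
    nlinarith [mul_nonneg (by linarith : (0 : ℝ) ≤ w + 1 / 3) (sq_nonneg (w - 2 / 3))]
  linarith

/-- Subtracting an affine function leaves the gap unchanged, and dividing by the rise of `g` scales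
it; this reduces to the normalized case. -/
lemma jensenGap_le_of_convex_deriv {B g : ℝ → ℝ} (hB : ∀ s, HasDerivAt B (g s) s)
    (hg : ConvexOn ℝ (Icc 0 1) g) (hg0 : ∀ s ∈ Icc (0 : ℝ) 1, g 0 ≤ g s) (h1 : g 0 < g 1)
    {a : ℝ} (ha : a ∈ Ioo (0 : ℝ) 1) :
    (1 - a) * B 0 + a * B 1 - B a ≤ 4 / 27 * (g 1 - g 0) := by
  have hpos : 0 < g 1 - g 0 := sub_pos.2 h1
  have := jensenGap_le_of_convex_deriv_normalized
    (B := fun s => (B s - g 0 * s) / (g 1 - g 0)) (g := fun s => (g s - g 0) / (g 1 - g 0))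
    (fun s => by
      have := ((hB s).sub ((hasDerivAt_id s).const_mul (g 0))).div_const (g 1 - g 0)
      simpa using this)
    (by
      have h2 := (hg.sub (concaveOn_const (g 0) (convex_Icc 0 1))).smul (inv_nonneg.2 hpos.le)
      refine h2.congr fun s _ => ?_
      simp only [Pi.sub_apply, smul_eq_mul, div_eq_mul_inv]
      ring)
    (fun s hs => div_nonneg (sub_nonneg.2 (hg0 s hs)) hpos.le) (by simp)
    (div_self hpos.ne') ha
  have e : (1 - a) * ((B 0 - g 0 * 0) / (g 1 - g 0)) + a * ((B 1 - g 0 * 1) / (g 1 - g 0)) -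
      (B a - g 0 * a) / (g 1 - g 0) = ((1 - a) * B 0 + a * B 1 - B a) / (g 1 - g 0) := by
    field_simp; ring
  rw [e, div_le_iff₀ hpos] at this
  exact this

/-! ### Bernoulli laws in natural parameters -/

/-- The log-partition function of the Bernoulli family, whose derivative is `sigmoid`. -/
noncomputable def logPartition (θ : ℝ) : ℝ := log (1 + exp θ)

lemma hasDerivAt_logPartition (θ : ℝ) : HasDerivAt logPartition (sigmoid θ) θ := by
  have h : 0 < 1 + exp θ := by positivity
  refine (((hasDerivAt_exp θ).const_add 1).log h.ne').congr_deriv ?_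
  rw [sigmoid_def, exp_neg]
  field_simp
  ring

lemma logPartition_neg (θ : ℝ) : logPartition (-θ) = logPartition θ - θ := by
  have h : 1 + exp (-θ) = (1 + exp θ) / exp θ := by rw [exp_neg]; field_simp; ring
  rw [logPartition, h, log_div (by positivity) (by positivity), log_exp, logPartition]

lemma one_sub_sigmoid_eq_exp (θ : ℝ) : 1 - sigmoid θ = exp (-logPartition θ) := by
  rw [← sigmoid_neg, sigmoid_def, neg_neg, exp_neg, logPartition, exp_log (by positivity)]

lemma sigmoid_eq_exp (θ : ℝ) : sigmoid θ = exp (θ - logPartition θ) := by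
  rw [← neg_neg θ, sigmoid_neg, one_sub_sigmoid_eq_exp, logPartition_neg (-θ)]
  ring_nf

/-- In an exponential family the geometric mixture of two members is a multiple of the member at the
mixed parameter, so minus the log of the Chernoff sum is a Jensen gap of the log-partition function.
-/
lemma log_sum_rpow_sigmoid (θ₀ θ₁ lam : ℝ) :
    log (sigmoid θ₀ ^ lam * sigmoid θ₁ ^ (1 - lam) +
      (1 - sigmoid θ₀) ^ lam * (1 - sigmoid θ₁) ^ (1 - lam)) =
    logPartition (lam * θ₀ + (1 - lam) * θ₁) -
      (lam * logPartition θ₀ + (1 - lam) * logPartition θ₁) := by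
  simp only [one_sub_sigmoid_eq_exp]
  simp only [sigmoid_eq_exp, ← exp_mul, ← exp_add]
  have e : exp ((θ₀ - logPartition θ₀) * lam + (θ₁ - logPartition θ₁) * (1 - lam)) +
      exp (-logPartition θ₀ * lam + -logPartition θ₁ * (1 - lam)) =
      (1 + exp (lam * θ₀ + (1 - lam) * θ₁)) *
        exp (-(lam * logPartition θ₀ + (1 - lam) * logPartition θ₁)) := by
    rw [add_mul, one_mul, ← exp_add, add_comm]
    congr 2 <;> ring
  rw [e, log_mul (by positivity) (by positivity), log_exp]
  simp only [logPartition]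
  ring

/-- The derivative `σ (1 - σ)` increases as long as `σ ≤ 1/2`. -/
lemma convexOn_sigmoid : ConvexOn ℝ (Iic 0) sigmoid := by
  apply MonotoneOn.convexOn_of_deriv (convex_Iic 0) continuous_sigmoid.continuousOn
    differentiable_sigmoid.differentiableOn
  intro x hx y hy hxy
  rw [interior_Iic] at hx hy
  simp only [deriv_sigmoid]
  have h1 := sigmoid_le hxy
  have h2 : sigmoid y ≤ 2⁻¹ := by rw [← sigmoid_zero]; exact sigmoid_le (le_of_lt hy)
  nlinarith

lemma jensenGap_logPartition_le_of_nonpos {θ₀ θ₁ lam : ℝ} (h : θ₀ ≤ θ₁) (h1 : θ₁ ≤ 0)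
    (hl : lam ∈ Ioo (0 : ℝ) 1) :
    lam * logPartition θ₀ + (1 - lam) * logPartition θ₁ -
      logPartition (lam * θ₀ + (1 - lam) * θ₁) ≤
    4 / 27 * ((sigmoid θ₁ - sigmoid θ₀) * (θ₁ - θ₀)) := by
  rcases h.eq_or_lt with rfl | hlt
  · ring_nf; simp
  have hR : 0 < θ₁ - θ₀ := sub_pos.2 hlt
  have key := jensenGap_le_of_convex_deriv (a := 1 - lam)
    (B := fun s => logPartition (θ₀ + s * (θ₁ - θ₀)))
    (g := fun s => sigmoid (θ₀ + s * (θ₁ - θ₀)) * (θ₁ - θ₀))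
    (fun s => by
      have := (hasDerivAt_logPartition (θ₀ + s * (θ₁ - θ₀))).comp s
        (((hasDerivAt_id s).mul_const (θ₁ - θ₀)).const_add θ₀)
      exact this.congr_deriv (by simp))
    (by
      refine ⟨convex_Icc 0 1, fun x hx y hy p q hp hq hpq => ?_⟩
      have hmem : ∀ z ∈ Icc (0 : ℝ) 1, θ₀ + z * (θ₁ - θ₀) ∈ Iic (0 : ℝ) := fun z hz => by
        have := mul_le_mul_of_nonneg_right hz.2 hR.le
        simp only [mem_Iic]; linarith
      have := convexOn_mul_add_mul_le convexOn_sigmoid (hmem x hx) (hmem y hy) hp hq hpq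
      have e : p * (θ₀ + x * (θ₁ - θ₀)) + q * (θ₀ + y * (θ₁ - θ₀)) =
          θ₀ + (p * x + q * y) * (θ₁ - θ₀) := by
        linear_combination hpq * θ₀
      rw [e] at this
      simp only [smul_eq_mul]
      nlinarith [mul_le_mul_of_nonneg_right this hR.le])
    (fun s hs => by
      refine mul_le_mul_of_nonneg_right (sigmoid_le ?_) hR.le
      have := mul_nonneg hs.1 hR.le
      linarith)
    (by
      refine mul_lt_mul_of_pos_right (sigmoid_lt ?_) hR
      linarith)
    ⟨by linarith [hl.2], by linarith [hl.1]⟩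
  have e1 : θ₀ + (1 - lam) * (θ₁ - θ₀) = lam * θ₀ + (1 - lam) * θ₁ := by ring
  have e2 : θ₀ + 1 * (θ₁ - θ₀) = θ₁ := by ring
  have e3 : θ₀ + 0 * (θ₁ - θ₀) = θ₀ := by ring
  simp only [e1, e2, e3] at key
  linarith

/-- Reflection `θ ↦ -θ` changes the log-partition function only by a linear term, hence preserves
Jensen gaps. -/
lemma jensenGap_logPartition_le_of_nonneg {θ₀ θ₁ lam : ℝ} (h : θ₀ ≤ θ₁) (h0 : 0 ≤ θ₀)
    (hl : lam ∈ Ioo (0 : ℝ) 1) :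
    lam * logPartition θ₀ + (1 - lam) * logPartition θ₁ -
      logPartition (lam * θ₀ + (1 - lam) * θ₁) ≤
    4 / 27 * ((sigmoid θ₁ - sigmoid θ₀) * (θ₁ - θ₀)) := by
  have := jensenGap_logPartition_le_of_nonpos (neg_le_neg h) (neg_nonpos.2 h0)
    (lam := 1 - lam) ⟨by linarith [hl.2], by linarith [hl.1]⟩
  have e : (1 - lam) * -θ₁ + (1 - (1 - lam)) * -θ₀ = -(lam * θ₀ + (1 - lam) * θ₁) := by ring
  rw [e] at this
  simp only [logPartition_neg, sigmoid_neg] at this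
  linarith

/-- The second derivative of `logPartition` is a Bernoulli variance, at most `1/4`, so the gap is at
most that of `θ ^ 2 / 8`; then `λ (1 - λ) ≤ 1/4`. -/
lemma jensenGap_logPartition_le_sq {θ₀ θ₁ lam : ℝ} (hl : lam ∈ Ioo (0 : ℝ) 1) :
    lam * logPartition θ₀ + (1 - lam) * logPartition θ₁ -
      logPartition (lam * θ₀ + (1 - lam) * θ₁) ≤ (θ₁ - θ₀) ^ 2 / 32 := by
  have hd : ∀ θ, HasDerivAt (fun θ : ℝ => θ ^ 2 / 8 - logPartition θ) (θ / 4 - sigmoid θ) θ := by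
    intro θ
    have := (((hasDerivAt_id θ).pow 2).div_const 8).sub (hasDerivAt_logPartition θ)
    exact this.congr_deriv (by simp; ring)
  have hdd : ∀ θ, HasDerivAt (fun θ : ℝ => θ / 4 - sigmoid θ)
      (1 / 4 - sigmoid θ * (1 - sigmoid θ)) θ := fun θ =>
    ((hasDerivAt_id θ).div_const 4).sub (hasDerivAt_sigmoid θ)
  have hconv : ConvexOn ℝ univ (fun θ : ℝ => θ ^ 2 / 8 - logPartition θ) := by
    apply MonotoneOn.convexOn_of_deriv convex_univ
    · exact fun s _ => (hd s).continuousAt.continuousWithinAt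
    · exact fun s _ => (hd s).differentiableAt.differentiableWithinAt
    · rw [funext fun θ => (hd θ).deriv]
      refine (monotone_of_deriv_nonneg (fun θ => (hdd θ).differentiableAt) fun θ => ?_).monotoneOn _
      rw [(hdd θ).deriv]
      nlinarith [sq_nonneg (sigmoid θ - 1 / 2)]
  have := convexOn_mul_add_mul_le hconv (mem_univ θ₀) (mem_univ θ₁) hl.1.le
    (by linarith [hl.2] : 0 ≤ 1 - lam) (by ring)
  nlinarith [mul_nonneg (sq_nonneg (lam - 1 / 2)) (sq_nonneg (θ₁ - θ₀))]

/-! ### Bounds for hyperbolic functions and logarithms -/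

lemma sinh_le_mul_cosh {s : ℝ} (hs : 0 ≤ s) : sinh s ≤ s * cosh s := by
  have hd : ∀ x, HasDerivAt (fun x : ℝ => x * cosh x - sinh x) (x * sinh x) x := fun x =>
    (((hasDerivAt_id x).mul (hasDerivAt_cosh x)).sub (hasDerivAt_sinh x)).congr_deriv
      (by simp)
  have : MonotoneOn (fun x : ℝ => x * cosh x - sinh x) (Ici 0) := by
    apply monotoneOn_of_deriv_nonneg (convex_Ici 0)
    · exact fun s _ => (hd s).continuousAt.continuousWithinAt
    · exact fun s _ => (hd s).differentiableAt.differentiableWithinAt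
    · intro x hx
      rw [interior_Ici] at hx
      rw [(hd x).deriv]
      exact mul_nonneg (le_of_lt hx) (sinh_nonneg_iff.2 (le_of_lt hx))
  have := this (a := 0) (b := s) (by simp) hs hs
  simp at this
  linarith

lemma div_le_tanh {s : ℝ} (hs : 0 ≤ s) : 3 * s / (3 + s ^ 2) ≤ tanh s := by
  have hd : ∀ x, HasDerivAt (fun x : ℝ => (3 + x ^ 2) * sinh x - 3 * x * cosh x)
      (x * (x * cosh x - sinh x)) x := fun x =>
    (((((hasDerivAt_id x).pow 2).const_add 3).mul (hasDerivAt_sinh x)).sub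
      (((hasDerivAt_id x).const_mul 3).mul (hasDerivAt_cosh x))).congr_deriv
      (by simp; ring)
  have : MonotoneOn (fun x : ℝ => (3 + x ^ 2) * sinh x - 3 * x * cosh x) (Ici 0) := by
    apply monotoneOn_of_deriv_nonneg (convex_Ici 0)
    · exact fun s _ => (hd s).continuousAt.continuousWithinAt
    · exact fun s _ => (hd s).differentiableAt.differentiableWithinAt
    · intro x hx
      rw [interior_Ici] at hx
      rw [(hd x).deriv]
      exact mul_nonneg (le_of_lt hx) (sub_nonneg.2 (sinh_le_mul_cosh (le_of_lt hx)))
  have := this (a := 0) (b := s) (by simp) hs hs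
  simp at this
  rw [tanh_eq_sinh_div_cosh, div_le_div_iff₀ (by positivity) (cosh_pos s)]
  linarith

lemma tanh_monotone : Monotone tanh := fun x y hxy => by
  rw [tanh_eq_sinh_div_cosh, tanh_eq_sinh_div_cosh, div_le_div_iff₀ (cosh_pos _) (cosh_pos _)]
  have := sinh_nonneg_iff.2 (sub_nonneg.2 hxy)
  rw [sinh_sub] at this
  linarith

lemma sigmoid_eq_tanh (θ : ℝ) : sigmoid θ = (1 + tanh (θ / 2)) / 2 := by
  have h : exp (-θ) = exp (-(θ / 2)) / exp (θ / 2) := by rw [← exp_sub]; congr 1; ring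
  rw [sigmoid_def, h, tanh_eq_sinh_div_cosh, sinh_eq, cosh_eq]
  have := exp_pos (θ / 2)
  have := exp_pos (-(θ / 2))
  field_simp
  ring

lemma tanh_add_le {x y : ℝ} (hx : 0 ≤ x) (hy : 0 ≤ y) : tanh (x + y) ≤ tanh x + tanh y := by
  simp only [tanh_eq_sinh_div_cosh]
  have h1 := cosh_pos x
  have h2 := cosh_pos y
  have h3 := cosh_pos (x + y)
  rw [div_add_div _ _ h1.ne' h2.ne', div_le_div_iff₀ h3 (by positivity)]
  rw [← sinh_add]
  apply mul_le_mul_of_nonneg_left _ (sinh_nonneg_iff.2 (by positivity))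
  rw [cosh_add]
  have := mul_nonneg (sinh_nonneg_iff.2 hx) (sinh_nonneg_iff.2 hy)
  linarith

/-- When the parameters straddle `0`, the difference of sigmoids is half a sum of two nonnegative
`tanh` values, and `tanh` is subadditive there. -/
lemma half_tanh_le_sigmoid_sub {θ₀ θ₁ : ℝ} (h0 : θ₀ ≤ 0) (h1 : 0 ≤ θ₁) :
    tanh ((θ₁ - θ₀) / 2) / 2 ≤ sigmoid θ₁ - sigmoid θ₀ := by
  have := tanh_add_le (x := θ₁ / 2) (y := -(θ₀ / 2)) (by linarith) (by linarith)
  rw [tanh_neg] at this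
  rw [sigmoid_eq_tanh, sigmoid_eq_tanh, show (θ₁ - θ₀) / 2 = θ₁ / 2 + -(θ₀ / 2) by ring]
  linarith

lemma le_neg_log_one_sub {z : ℝ} (hz0 : 0 ≤ z) (hz1 : z < 1) :
    z + z ^ 2 / 2 + z ^ 3 / 3 ≤ -log (1 - z) := by
  have h := hasSum_pow_div_log_of_abs_lt_one (x := z) (by rw [abs_of_nonneg hz0]; exact hz1)
  have := sum_le_hasSum (Finset.range 3) (fun i _ => by positivity) h
  norm_num [Finset.sum_range_succ] at this
  linarith

lemma le_log_div {x : ℝ} (hx0 : 0 ≤ x) (hx1 : x < 1) :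
    2 * (x + x ^ 3 / 3 + x ^ 5 / 5) ≤ log ((1 + x) / (1 - x)) := by
  have h := hasSum_log_sub_log_of_abs_lt_one (x := x) (by rw [abs_of_nonneg hx0]; exact hx1)
  have := sum_le_hasSum (Finset.range 3) (fun i _ => by positivity) h
  rw [log_div (by linarith) (by linarith)]
  norm_num [Finset.sum_range_succ] at this
  linarith

/-- The comparison of the balanced regime reduced to a polynomial inequality. -/
lemma pow_four_le_mul_polynomials {z : ℝ} (hz0 : 0 ≤ z) (hz1 : z ≤ 1) :
    (3 + 8 * z) ^ 4 ≤
      2 * (1 + z / 3 + z ^ 2 / 5) ^ 2 * (1 + z / 2 + z ^ 2 / 3) * (3 + 4 * z) ^ 4 := by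
  -- The two sides are closest near `z = 0.42`; the squares are centred there.
  have h : ∀ k : ℕ, 0 ≤ z ^ k * (z - 21 / 50) ^ 2 := fun k => by positivity
  have h0 := h 0
  have h1 := h 1
  have h2 := h 2
  have h3 := h 3
  have h4 := h 4
  have h7 : 0 ≤ z ^ 7 := by positivity
  have h8 : 0 ≤ z ^ 8 := by positivity
  have h9 : 0 ≤ z ^ 9 := by positivity
  have h10 : 0 ≤ z ^ 10 := by positivity
  nlinarith only [h0, h1, h2, h3, h4, h7, h8, h9, h10, hz0, hz1]

/-! ### The log-odds ratio and its contraction by a binary symmetric channel -/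

lemma sigmoid_div_one_sub_sigmoid (θ : ℝ) : sigmoid θ / (1 - sigmoid θ) = exp θ := by
  rw [one_sub_sigmoid_eq_exp, sigmoid_eq_exp, ← exp_sub]
  ring_nf

/-- The range of the log-likelihood ratio of two Bernoulli laws with parameters `p` and `q`. -/
noncomputable def logOddsRatio (p q : ℝ) : ℝ := log (q * (1 - p) / (p * (1 - q)))

lemma logOddsRatio_sigmoid (θ₀ θ₁ : ℝ) :
    logOddsRatio (sigmoid θ₀) (sigmoid θ₁) = θ₁ - θ₀ := by
  have h : sigmoid θ₁ * (1 - sigmoid θ₀) / (sigmoid θ₀ * (1 - sigmoid θ₁)) =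
      (sigmoid θ₁ / (1 - sigmoid θ₁)) / (sigmoid θ₀ / (1 - sigmoid θ₀)) := by
    have := (sigmoid_pos θ₀).ne'
    have := (sub_pos.2 (sigmoid_lt_one θ₀)).ne'
    have := (sub_pos.2 (sigmoid_lt_one θ₁)).ne'
    field_simp
  rw [logOddsRatio, h, sigmoid_div_one_sub_sigmoid, sigmoid_div_one_sub_sigmoid, ← exp_sub, log_exp]

/-- For fixed `q - p` the log-odds ratio is smallest at the symmetric pair `p + q = 1`, where it
equals the left side. -/
lemma two_mul_log_le_logOddsRatio {p q : ℝ} (hp : 0 < p) (hpq : p ≤ q) (hq : q < 1) :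
    2 * log ((1 + (q - p)) / (1 - (q - p))) ≤ logOddsRatio p q := by
  have h1 : 0 < 1 - (q - p) := by linarith
  have h2 : 0 < 1 + (q - p) := by linarith
  have hB : 0 < p * (1 - q) := mul_pos hp (by linarith)
  have e : 2 * log ((1 + (q - p)) / (1 - (q - p))) =
      log (((1 + (q - p)) / (1 - (q - p))) ^ 2) := by
    rw [log_pow]; norm_num
  rw [e, logOddsRatio]
  apply log_le_log (by positivity)
  rw [div_pow, div_le_div_iff₀ (by positivity) hB]
  nlinarith [mul_nonneg (sub_nonneg.2 hpq) (sq_nonneg (1 - p - q))]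

/-- Birkhoff contraction: a binary symmetric channel contracts the log-odds ratio. -/
lemma logOddsRatio_channel_le {t u v : ℝ} (ht0 : 0 ≤ t) (ht1 : t < 1) (hu : 0 < u) (huv : u ≤ v)
    (hv : v < 1) :
    logOddsRatio ((1 - t) / 2 + t * u) ((1 - t) / 2 + t * v) ≤ t * logOddsRatio u v := by
  have hpos : ∀ p, 0 < p → 0 < (1 - t) / 2 + t * p := fun p hp => by
    have := mul_nonneg ht0 hp.le
    linarith
  have hlt : ∀ p, p < 1 → (1 - t) / 2 + t * p < 1 := fun p hp => by nlinarith
  have hd : ∀ p ∈ Ioo (0 : ℝ) 1, HasDerivAt (fun p => t * (log p - log (1 - p)) -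
      (log ((1 - t) / 2 + t * p) - log (1 - ((1 - t) / 2 + t * p))))
      (t * (1 / p - -1 / (1 - p)) -
        (t / ((1 - t) / 2 + t * p) - -t / (1 - ((1 - t) / 2 + t * p)))) p := by
    intro p hp
    have h1 := (hasDerivAt_id p).log hp.1.ne'
    have h2 := ((hasDerivAt_id p).const_sub 1).log (sub_pos.2 hp.2).ne'
    have h3 : HasDerivAt (fun p => (1 - t) / 2 + t * p) t p :=
      (((hasDerivAt_id p).const_mul t).const_add ((1 - t) / 2)).congr_deriv (by simp)
    exact ((h1.sub h2).const_mul t).sub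
      ((h3.log (hpos p hp.1).ne').sub ((h3.const_sub 1).log (sub_pos.2 (hlt p hp.2)).ne'))
  have hmono : MonotoneOn (fun p => t * (log p - log (1 - p)) -
      (log ((1 - t) / 2 + t * p) - log (1 - ((1 - t) / 2 + t * p)))) (Ioo 0 1) := by
    apply monotoneOn_of_deriv_nonneg (convex_Ioo 0 1)
    · exact fun s hs => (hd s hs).continuousAt.continuousWithinAt
    · rw [interior_Ioo]
      exact fun s hs => (hd s hs).differentiableAt.differentiableWithinAt
    · intro p hp
      rw [interior_Ioo] at hp
      rw [(hd p hp).deriv]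
      have h1 := hp.1
      have h2 := sub_pos.2 hp.2
      have h3 := hpos p hp.1
      have h4 := sub_pos.2 (hlt p hp.2)
      set c := (1 - t) / 2 + t * p with hc
      have e : t * (1 / p - -1 / (1 - p)) - (t / c - -t / (1 - c)) =
          t * (1 / (p * (1 - p)) - 1 / (c * (1 - c))) := by
        field_simp; ring
      rw [e]
      refine mul_nonneg ht0 (sub_nonneg.2 (one_div_le_one_div_of_le (by positivity) ?_))
      -- The logit has derivative `1 / (p * (1 - p))`, and the channel moves `p` towards `1/2`,
      -- which increases the variance.
      have : c * (1 - c) - p * (1 - p) = (1 - t ^ 2) * (p - 1 / 2) ^ 2 := by rw [hc]; ring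
      nlinarith [mul_nonneg (by nlinarith : 0 ≤ 1 - t ^ 2) (sq_nonneg (p - 1 / 2))]
  have hu1 : u < 1 := huv.trans_lt hv
  have hv0 : 0 < v := hu.trans_le huv
  have key := hmono ⟨hu, hu1⟩ ⟨hv0, hv⟩ huv
  have hlog : ∀ p q, 0 < p → p < 1 → 0 < q → q < 1 →
      logOddsRatio p q = (log q - log (1 - q)) - (log p - log (1 - p)) := by
    intro p q hp hp1 hq hq1
    rw [logOddsRatio, log_div (mul_pos hq (sub_pos.2 hp1)).ne' (mul_pos hp (sub_pos.2 hq1)).ne',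
      log_mul hq.ne' (sub_pos.2 hp1).ne', log_mul hp.ne' (sub_pos.2 hq1).ne']
    ring
  rw [hlog _ _ (hpos u hu) (hlt u hu1) (hpos v hv0) (hlt v hv), hlog _ _ hu hu1 hv0 hv]
  simp only at key
  linarith

/-! ### The lower bound for the Chernoff information in terms of the range -/

/-- The sum `∑ Q₀^λ Q₁^(1-λ)` for two Bernoulli laws. -/
noncomputable def bernoulliChernoff (p q lam : ℝ) : ℝ :=
  p ^ lam * q ^ (1 - lam) + (1 - p) ^ lam * (1 - q) ^ (1 - lam)

/-- Cubing `x ^ 2 / 2 ≤ I` and squaring `I ≤ 4/27 * D * R` bounds `D ^ 2 * I * R ^ 2` below by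
`729/128 * x ^ 6`. On the other side `D * (2 * x - D) ^ 2` is largest at `D = 2 * x / 3`, which
gives the slightly smaller constant `4096/729`. -/
lemma convex_regime_bound {x D R I : ℝ} (hx : 0 ≤ x) (hD0 : 0 ≤ D) (hDx : D ≤ x)
    (h1 : x ^ 2 / 2 ≤ I) (h2 : I ≤ 4 / 27 * (D * R)) :
    4 * (2 * x - D) ^ 4 ≤ I * R ^ 2 := by
  have hI : 0 ≤ I := le_trans (by positivity) h1
  rcases hD0.eq_or_lt with rfl | hD
  · have : x ^ 2 ≤ 0 := by nlinarith
    have : x = 0 := by nlinarith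
    subst this
    simpa using mul_nonneg hI (sq_nonneg R)
  have h3 : D * (2 * x - D) ^ 2 ≤ 32 / 27 * x ^ 3 := by
    nlinarith [mul_nonneg (by linarith : 0 ≤ 8 / 3 * x - D) (sq_nonneg (D - 2 / 3 * x))]
  have h4 : (D * (2 * x - D) ^ 2) ^ 2 ≤ (32 / 27 * x ^ 3) ^ 2 :=
    pow_le_pow_left₀ (by positivity) h3 2
  have h5 : I ^ 2 ≤ (4 / 27 * (D * R)) ^ 2 := pow_le_pow_left₀ hI h2 2
  have h6 : (x ^ 2 / 2) ^ 3 ≤ I ^ 3 := pow_le_pow_left₀ (by positivity) h1 3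
  have h7 : I ^ 3 ≤ 16 / 729 * (D ^ 2 * (I * R ^ 2)) := by
    have := mul_le_mul_of_nonneg_left h5 hI
    calc I ^ 3 = I * I ^ 2 := by ring
      _ ≤ _ := this
      _ = _ := by ring
  have h8 : 0 ≤ x ^ 6 := by positivity
  refine le_of_mul_le_mul_left (a := D ^ 2) ?_ (by positivity)
  nlinarith

/-- Truncating the power series of both logarithms after three terms turns the claim into a
polynomial inequality in `z = x ^ 2`. -/
lemma balanced_regime_bound {x D R I : ℝ} (hx : 0 ≤ x) (hx1 : x < 1) (hDx : D ≤ x)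
    (h1 : -log (1 - x ^ 2) / 2 ≤ I) (h2 : 2 * log ((1 + x) / (1 - x)) ≤ R)
    (h3 : 3 * x / (3 + 4 * x ^ 2) ≤ D) :
    4 * (2 * x - D) ^ 4 ≤ I * R ^ 2 := by
  have hz1 : x ^ 2 < 1 := by nlinarith
  have hpsi := le_neg_log_one_sub (sq_nonneg x) hz1
  have hat := le_log_div hx hx1
  have hI : x ^ 2 * (1 + x ^ 2 / 2 + (x ^ 2) ^ 2 / 3) / 2 ≤ I := by nlinarith
  have hR : 4 * (x * (1 + x ^ 2 / 3 + (x ^ 2) ^ 2 / 5)) ≤ R := by nlinarith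
  have hD : 2 * x - D ≤ x * (3 + 8 * x ^ 2) / (3 + 4 * x ^ 2) := by
    have : x * (3 + 8 * x ^ 2) / (3 + 4 * x ^ 2) = 2 * x - 3 * x / (3 + 4 * x ^ 2) := by
      field_simp; ring
    linarith
  have hpoly := pow_four_le_mul_polynomials (sq_nonneg x) hz1.le
  set z := x ^ 2 with hz
  have hz0 : 0 ≤ z := sq_nonneg x
  have hI0 : 0 ≤ I := le_trans (by positivity) hI
  calc 4 * (2 * x - D) ^ 4 ≤ 4 * (x * (3 + 8 * z) / (3 + 4 * z)) ^ 4 := by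
        gcongr
        linarith
    _ = 4 * z ^ 2 * ((3 + 8 * z) ^ 4 / (3 + 4 * z) ^ 4) := by
        rw [div_pow, mul_pow, hz]; ring
    _ ≤ 4 * z ^ 2 * (2 * (1 + z / 3 + z ^ 2 / 5) ^ 2 * (1 + z / 2 + z ^ 2 / 3)) := by
        gcongr
        rw [div_le_iff₀ (by positivity)]
        exact hpoly
    _ = (z * (1 + z / 2 + z ^ 2 / 3) / 2) * (4 * (x * (1 + z / 3 + z ^ 2 / 5))) ^ 2 := by
        rw [mul_pow, mul_pow, ← hz]; ring
    _ ≤ I * R ^ 2 := by gcongr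

/-- If the Chernoff information `I` of two Bernoulli laws is at least that of any pair at total
variation distance `x`, then it is bounded below in terms of `x`, the distance of the two laws and
the range of their log-likelihood ratio. -/
lemma chernoff_mul_sq_ge {p q x R I : ℝ} (hp : 0 < p) (hpq : p ≤ q) (hq : q < 1) (hx : 0 ≤ x)
    (hx1 : x < 1) (hqp : q - p ≤ x) (hlow : -log (1 - x ^ 2) / 2 ≤ I)
    (hupp : ∀ c, (∀ lam ∈ Ioo (0 : ℝ) 1, -log (bernoulliChernoff p q lam) ≤ c) → I ≤ c)
    (hR : logOddsRatio p q ≤ R) (hR' : 2 * log ((1 + x) / (1 - x)) ≤ R) :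
    4 * (2 * x - (q - p)) ^ 4 ≤ I * R ^ 2 := by
  obtain ⟨θ₀, rfl⟩ : p ∈ range sigmoid := by rw [range_sigmoid]; exact ⟨hp, hpq.trans_lt hq⟩
  obtain ⟨θ₁, rfl⟩ : q ∈ range sigmoid := by rw [range_sigmoid]; exact ⟨hp.trans_le hpq, hq⟩
  have hθ : θ₀ ≤ θ₁ := sigmoid_le_iff.1 hpq
  rw [logOddsRatio_sigmoid] at hR
  simp only [bernoulliChernoff, log_sum_rpow_sigmoid, neg_sub] at hupp
  have hz1 : x ^ 2 < 1 := by nlinarith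
  have hI : x ^ 2 / 2 ≤ I := by
    have := le_neg_log_one_sub (sq_nonneg x) hz1
    have h4 : 0 ≤ (x ^ 2) ^ 2 := by positivity
    have h6 : 0 ≤ (x ^ 2) ^ 3 := by positivity
    linarith
  have hD0 : 0 ≤ sigmoid θ₁ - sigmoid θ₀ := sub_nonneg.2 hpq
  have hconv : I ≤ 4 / 27 * ((sigmoid θ₁ - sigmoid θ₀) * (θ₁ - θ₀)) →
      4 * (2 * x - (sigmoid θ₁ - sigmoid θ₀)) ^ 4 ≤ I * R ^ 2 := fun h => by
    refine convex_regime_bound hx hD0 hqp hI (h.trans ?_)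
    gcongr
  -- Parameters of equal sign fall under the convex regime, directly or by reflection; only the
  -- straddling case remains afterwards.
  rcases le_total θ₁ 0 with h1 | h1
  · exact hconv (hupp _ fun lam hl => jensenGap_logPartition_le_of_nonpos hθ h1 hl)
  rcases le_total 0 θ₀ with h0 | h0
  · exact hconv (hupp _ fun lam hl => jensenGap_logPartition_le_of_nonneg hθ h0 hl)
  refine balanced_regime_bound hx hx1 hqp hlow hR' ?_
  have hsq : I ≤ (θ₁ - θ₀) ^ 2 / 32 := hupp _ fun lam hl => jensenGap_logPartition_le_sq hl
  -- From `x ^ 2 / 2 ≤ I ≤ (θ₁ - θ₀) ^ 2 / 32`.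
  have hge : 4 * x ≤ θ₁ - θ₀ := by
    apply le_of_sq_le_sq _ (sub_nonneg.2 hθ)
    nlinarith
  calc 3 * x / (3 + 4 * x ^ 2) = 3 * (2 * x) / (3 + (2 * x) ^ 2) / 2 := by
        rw [mul_pow]; norm_num; ring
    _ ≤ tanh (2 * x) / 2 := by
        have := div_le_tanh (s := 2 * x) (by positivity)
        linarith
    _ ≤ tanh ((θ₁ - θ₀) / 2) / 2 := by
        have := tanh_monotone (by linarith : 2 * x ≤ (θ₁ - θ₀) / 2)
        linarith
    _ ≤ _ := half_tanh_le_sigmoid_sub h0 h1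

/-- The Bhattacharyya coefficient of two Bernoulli laws at total variation distance `|p - q|`. -/
lemma bernoulliChernoff_half_sq_le {p q : ℝ} (hp : p ∈ Icc (0 : ℝ) 1) (hq : q ∈ Icc (0 : ℝ) 1) :
    bernoulliChernoff p q (1 / 2) ^ 2 ≤ 1 - (q - p) ^ 2 := by
  have hp' : 0 ≤ 1 - p := sub_nonneg.2 hp.2
  have hq' : 0 ≤ 1 - q := sub_nonneg.2 hq.2
  rw [bernoulliChernoff, show (1 : ℝ) - 1 / 2 = 1 / 2 by norm_num]
  simp only [← sqrt_eq_rpow]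
  have a1 := sq_sqrt hp.1
  have a2 := sq_sqrt hq.1
  have a3 := sq_sqrt hp'
  have a4 := sq_sqrt hq'
  set a := √p
  set b := √q
  set c := √(1 - p)
  set d := √(1 - q)
  have h1 : c ^ 2 = 1 - a ^ 2 := by linarith
  have h2 : d ^ 2 = 1 - b ^ 2 := by linarith
  rw [← a1, ← a2]
  have h := sq_nonneg (a * c - b * d)
  have e : (a * c - b * d) ^ 2 = a ^ 2 * c ^ 2 + b ^ 2 * d ^ 2 - 2 * (a * b * c * d) := by ring
  have e2 : (a * b + c * d) ^ 2 = a ^ 2 * b ^ 2 + c ^ 2 * d ^ 2 + 2 * (a * b * c * d) := by ring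
  rw [e, h1, h2] at h
  rw [e2, h1, h2]
  linarith

/-! ### The sensitivity bounds the range of the privatized log-likelihood ratio -/

variable {A : Type*} [Fintype A]

/-- A finite supremum of likelihood ratios is at least `1`, as summing the pointwise domination over
the alphabet shows; so its logarithm is a nonnegative real. -/
lemma renyiInf_eq_top_or {P Q : A → ℝ} (hP : P ∈ stdSimplex ℝ A) (hQ : Q ∈ stdSimplex ℝ A) :
    renyiInf P Q = ⊤ ∨
      ∃ r : ℝ, renyiInf P Q = (r : EReal) ∧ 0 ≤ r ∧ ∀ x, P x ≤ exp r * Q x := by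
  set M := ⨆ a, ENNReal.ofReal (P a) / ENNReal.ofReal (Q a) with hM
  by_cases htop : M = ⊤
  · left
    rw [renyiInf, ← hM, htop, ENNReal.log_top]
  right
  have hle : ∀ x, P x ≤ M.toReal * Q x := by
    intro x
    have h1 : ENNReal.ofReal (P x) / ENNReal.ofReal (Q x) ≤ M :=
      le_iSup (fun a => ENNReal.ofReal (P a) / ENNReal.ofReal (Q a)) x
    have h2 : ENNReal.ofReal (P x) ≤ M * ENNReal.ofReal (Q x) :=
      (ENNReal.div_le_iff_le_mul (Or.inr htop) (Or.inl ENNReal.ofReal_ne_top)).1 h1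
    have h3 := ENNReal.toReal_mono (ENNReal.mul_ne_top htop ENNReal.ofReal_ne_top) h2
    rwa [ENNReal.toReal_mul, ENNReal.toReal_ofReal (hP.1 x), ENNReal.toReal_ofReal (hQ.1 x)] at h3
  have hone : 1 ≤ M.toReal := by
    have := Finset.sum_le_sum fun x (_ : x ∈ Finset.univ) => hle x
    rwa [← Finset.mul_sum, hP.2, hQ.2, mul_one] at this
  have hMpos : M ≠ 0 := by
    intro h
    rw [h] at hone
    simp at hone
    linarith
  refine ⟨log M.toReal, ?_, log_nonneg hone, fun x => ?_⟩
  · rw [renyiInf, ← hM, ENNReal.log_pos_real hMpos htop]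
  · rw [exp_log (by linarith)]
    exact hle x

lemma tanh_half_pos {ε : ℝ} (hε : 0 < ε) : 0 < tanh (ε / 2) := by
  rw [tanh_eq_sinh_div_cosh]
  exact div_pos (sinh_pos_iff.2 (by linarith)) (cosh_pos _)

lemma tanh_half_lt_one (ε : ℝ) : tanh (ε / 2) < 1 := by
  have := sigmoid_lt_one ε
  rw [sigmoid_eq_tanh] at this
  linarith

lemma logOddsRatio_self (p : ℝ) : logOddsRatio p p = 0 := by
  rw [logOddsRatio]
  rcases eq_or_ne (p * (1 - p)) 0 with h | h
  · simp [h]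
  · rw [div_self h, log_one]

/-- The channel outputs lie in `[(1 - t) / 2, (1 + t) / 2]`, whose endpoints have ratio `exp ε`;
this ratio enters twice. -/
lemma logOddsRatio_channel_le_two_mul {ε u v : ℝ} (hε : 0 < ε) (hu : u ∈ Icc (0 : ℝ) 1)
    (hv : v ∈ Icc (0 : ℝ) 1) :
    logOddsRatio ((1 - tanh (ε / 2)) / 2 + tanh (ε / 2) * u)
      ((1 - tanh (ε / 2)) / 2 + tanh (ε / 2) * v) ≤ 2 * ε := by
  have ht0 := tanh_half_pos hε
  have ht1 := tanh_half_lt_one ε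
  have hexp := sigmoid_div_one_sub_sigmoid ε
  rw [sigmoid_eq_tanh] at hexp
  set t := tanh (ε / 2)
  have hb : 0 < (1 - t) / 2 := by linarith
  have hlo : ∀ w ∈ Icc (0 : ℝ) 1, (1 - t) / 2 ≤ (1 - t) / 2 + t * w := fun w hw => by
    have := mul_nonneg ht0.le hw.1
    linarith
  have hhi : ∀ w ∈ Icc (0 : ℝ) 1, (1 - t) / 2 + t * w ≤ (1 + t) / 2 := fun w hw => by
    have := mul_le_mul_of_nonneg_left hw.2 ht0.le
    linarith
  have h1 := hlo u hu
  have h2 := hhi u hu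
  have h3 := hlo v hv
  have h4 := hhi v hv
  have e : 2 * ε = log (((1 + t) / 2 / ((1 - t) / 2)) ^ 2) := by
    rw [show (1 + t) / 2 / ((1 - t) / 2) = exp ε by rw [← hexp]; congr 1; ring, log_pow, log_exp]
    norm_num
  rw [e, logOddsRatio]
  set a := (1 - t) / 2 + t * u
  set c := (1 - t) / 2 + t * v
  apply log_le_log
  · apply div_pos <;> apply mul_pos <;> linarith
  rw [div_pow, sq, sq]
  apply div_le_div₀
  · positivity
  · apply mul_le_mul <;> linarith
  · positivity
  · apply mul_le_mul <;> linarith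

lemma sum_mem_Icc_of_stdSimplex {P : A → ℝ} (hP : P ∈ stdSimplex ℝ A) (T : Finset A) :
    ∑ x ∈ T, P x ∈ Icc (0 : ℝ) 1 := by
  refine ⟨Finset.sum_nonneg fun x _ => hP.1 x, ?_⟩
  rw [← hP.2]
  exact Finset.sum_le_univ_sum_of_nonneg hP.1

/-- The range of the privatized log-likelihood ratio is at most `s_b`. -/
lemma logOddsRatio_channel_le_sB {ε : ℝ} (hε : 0 < ε) {P₀ P₁ : A → ℝ}
    (hP₀ : P₀ ∈ stdSimplex ℝ A) (hP₁ : P₁ ∈ stdSimplex ℝ A) (T : Finset A)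
    (hT : ∑ x ∈ T, P₀ x ≤ ∑ x ∈ T, P₁ x) :
    logOddsRatio ((1 - tanh (ε / 2)) / 2 + tanh (ε / 2) * ∑ x ∈ T, P₀ x)
      ((1 - tanh (ε / 2)) / 2 + tanh (ε / 2) * ∑ x ∈ T, P₁ x) ≤ sB ε P₀ P₁ := by
  classical
  have hu := sum_mem_Icc_of_stdSimplex hP₀ T
  have hv := sum_mem_Icc_of_stdSimplex hP₁ T
  have hcu : 1 - ∑ x ∈ T, P₀ x = ∑ x ∈ Tᶜ, P₀ x := by
    rw [← hP₀.2, ← Finset.sum_add_sum_compl T]; ring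
  have hcv : 1 - ∑ x ∈ T, P₁ x = ∑ x ∈ Tᶜ, P₁ x := by
    rw [← hP₁.2, ← Finset.sum_add_sum_compl T]; ring
  have ht0 := tanh_half_pos hε
  have ht1 := tanh_half_lt_one ε
  have h2ε := logOddsRatio_channel_le_two_mul hε hu hv
  -- The cap `2 * ε` keeps the minimum in `sB` finite, so both bounds can be combined in `EReal`
  -- before `toReal`.
  suffices h : ((logOddsRatio ((1 - tanh (ε / 2)) / 2 + tanh (ε / 2) * ∑ x ∈ T, P₀ x)
      ((1 - tanh (ε / 2)) / 2 + tanh (ε / 2) * ∑ x ∈ T, P₁ x) : ℝ) : EReal) ≤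
      (tanh (ε / 2) : EReal) * sensitivity P₀ P₁ by
    have := EReal.toReal_le_toReal (le_min (EReal.coe_le_coe_iff.2 h2ε) h) (EReal.coe_ne_bot _)
      ((min_le_left _ _).trans_lt (EReal.coe_lt_top _)).ne
    rwa [EReal.toReal_coe] at this
  rw [sensitivity]
  rcases renyiInf_eq_top_or hP₁ hP₀ with h1 | ⟨r₁, h1, hr1, hb1⟩
  · rcases renyiInf_eq_top_or hP₀ hP₁ with h0 | ⟨r₀, h0, hr0, hb0⟩
    · rw [h0, h1, EReal.top_add_top, EReal.coe_mul_top_of_pos ht0]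
      exact le_top
    · rw [h0, h1, EReal.top_add_coe, EReal.coe_mul_top_of_pos ht0]
      exact le_top
  rcases renyiInf_eq_top_or hP₀ hP₁ with h0 | ⟨r₀, h0, hr0, hb0⟩
  · rw [h0, h1, EReal.coe_add_top, EReal.coe_mul_top_of_pos ht0]
    exact le_top
  rw [h0, h1, ← EReal.coe_add, ← EReal.coe_mul, EReal.coe_le_coe_iff]
  have hvu : ∑ x ∈ T, P₁ x ≤ exp r₁ * ∑ x ∈ T, P₀ x := by
    rw [Finset.mul_sum]
    exact Finset.sum_le_sum fun x _ => hb1 x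
  have huv : 1 - ∑ x ∈ T, P₀ x ≤ exp r₀ * (1 - ∑ x ∈ T, P₁ x) := by
    rw [hcu, hcv, Finset.mul_sum]
    exact Finset.sum_le_sum fun x _ => hb0 x
  set u := ∑ x ∈ T, P₀ x
  set v := ∑ x ∈ T, P₁ x
  rcases hT.eq_or_lt with h | h
  · rw [h, logOddsRatio_self]
    positivity
  -- Finite divergences give absolute continuity both ways, so `u < v` excludes the degenerate
  -- values `u = 0` and `v = 1`.
  have hu0 : 0 < u := by
    rcases hu.1.eq_or_lt with h' | h'
    · rw [← h'] at hvu h; linarith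
    · exact h'
  have hv1 : v < 1 := by
    rcases hv.2.eq_or_lt with h' | h'
    · rw [h'] at huv h; linarith
    · exact h'
  refine (logOddsRatio_channel_le ht0.le ht1 hu0 h.le hv1).trans ?_
  refine mul_le_mul_of_nonneg_left ?_ ht0.le
  have hv1' : 0 < 1 - v := sub_pos.2 hv1
  have hu1' : 0 < 1 - u := by linarith
  have hv0 : 0 < v := hu0.trans h
  rw [logOddsRatio, ← log_exp (r₁ + r₀), exp_add]
  apply log_le_log (by positivity)
  rw [div_le_iff₀ (by positivity)]
  calc v * (1 - u) ≤ (exp r₁ * u) * (exp r₀ * (1 - v)) := by gcongr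
    _ = _ := by ring

end BMCPD

namespace BMCPD

open Real Set

/-! ### The binary mechanism: privacy and output laws -/

section Mechanism

variable {A : Type*} [Fintype A]

lemma binaryMechanism_eq (ε : ℝ) (P₀ P₁ : A → ℝ) (τ : ℝ) (x : A) (y : Fin 2) :
    binaryMechanism ε P₀ P₁ τ x y = binaryRR ε (quantizer P₀ P₁ τ x) y := by
  simp [binaryMechanism]

lemma binaryRR_nonneg (ε : ℝ) (v y : Fin 2) : 0 ≤ binaryRR ε v y := by
  rw [binaryRR]
  split_ifs <;> positivity

lemma sum_binaryRR (ε : ℝ) (v : Fin 2) : ∑ y, binaryRR ε v y = 1 := by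
  have : exp ε + 1 ≠ 0 := by positivity
  fin_cases v <;> simp [binaryRR, Fin.sum_univ_two] <;> field_simp
  ring

lemma binaryRR_le {ε : ℝ} (hε : 0 ≤ ε) (v v' y : Fin 2) :
    binaryRR ε v y ≤ exp ε * binaryRR ε v' y := by
  have h1 : 1 ≤ exp ε := one_le_exp hε
  have hup : binaryRR ε v y ≤ exp ε / (exp ε + 1) := by
    rw [binaryRR]
    split_ifs
    · exact le_rfl
    · gcongr
  have hlo : 1 / (exp ε + 1) ≤ binaryRR ε v' y := by
    rw [binaryRR]
    split_ifs
    · gcongr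
    · exact le_rfl
  calc binaryRR ε v y ≤ exp ε * (1 / (exp ε + 1)) := by rwa [mul_one_div]
    _ ≤ _ := by gcongr

lemma isLDP_binaryMechanism {ε : ℝ} (hε : 0 ≤ ε) (P₀ P₁ : A → ℝ) (τ : ℝ) :
    IsLDP ε (binaryMechanism ε P₀ P₁ τ) where
  nonneg x y := by
    rw [binaryMechanism_eq]
    exact binaryRR_nonneg _ _ _
  sum_eq_one x := by
    simp only [binaryMechanism_eq]
    exact sum_binaryRR _ _
  ldp x x' S := by
    simp only [binaryMechanism_eq]
    rw [Finset.mul_sum]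
    exact Finset.sum_le_sum fun y _ => binaryRR_le hε _ _ y

lemma exp_div_exp_add_one (ε : ℝ) : exp ε / (exp ε + 1) = (1 + tanh (ε / 2)) / 2 := by
  rw [← sigmoid_eq_tanh, sigmoid_def, exp_neg]
  field_simp

lemma one_div_exp_add_one (ε : ℝ) : 1 / (exp ε + 1) = (1 - tanh (ε / 2)) / 2 := by
  have h : exp ε / (exp ε + 1) + 1 / (exp ε + 1) = 1 := by
    have : exp ε + 1 ≠ 0 := by positivity
    field_simp
  rw [exp_div_exp_add_one] at h
  linarith

lemma sum_add_sum_compl_of_stdSimplex [DecidableEq A] {P : A → ℝ} (hP : P ∈ stdSimplex ℝ A)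
    (T : Finset A) : ∑ x ∈ T, P x + ∑ x ∈ Tᶜ, P x = 1 := by
  rw [Finset.sum_add_sum_compl, hP.2]

/-- Randomized response is a binary symmetric channel with slope `tanh (ε / 2)`, applied to the
probability of bit `1`. -/
lemma inducedBM_one [DecidableEq A] (ε : ℝ) (P₀ P₁ : A → ℝ) (τ : ℝ) {P : A → ℝ}
    (hP : P ∈ stdSimplex ℝ A) :
    inducedBM ε P₀ P₁ τ P 1 = (1 - tanh (ε / 2)) / 2 +
      tanh (ε / 2) * ∑ x ∈ (likelihoodSet P₀ P₁ τ)ᶜ, P x := by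
  rw [inducedBM, induced, ← Finset.sum_add_sum_compl (likelihoodSet P₀ P₁ τ)]
  have h0 : ∀ x ∈ likelihoodSet P₀ P₁ τ,
      P x * binaryMechanism ε P₀ P₁ τ x 1 = P x * ((1 - tanh (ε / 2)) / 2) := by
    intro x hx
    rw [binaryMechanism_eq, quantizer, if_pos hx, binaryRR, if_neg (by decide),
      one_div_exp_add_one]
  have h1 : ∀ x ∈ (likelihoodSet P₀ P₁ τ)ᶜ,
      P x * binaryMechanism ε P₀ P₁ τ x 1 = P x * ((1 + tanh (ε / 2)) / 2) := by
    intro x hx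
    rw [binaryMechanism_eq, quantizer, if_neg (Finset.mem_compl.1 hx), binaryRR, if_pos rfl,
      exp_div_exp_add_one]
  rw [Finset.sum_congr rfl h0, Finset.sum_congr rfl h1, ← Finset.sum_mul, ← Finset.sum_mul]
  have := sum_add_sum_compl_of_stdSimplex hP (likelihoodSet P₀ P₁ τ)
  linear_combination ((1 - tanh (ε / 2)) / 2) * this

lemma sum_inducedBM (ε : ℝ) (P₀ P₁ : A → ℝ) (τ : ℝ) {P : A → ℝ} (hP : P ∈ stdSimplex ℝ A) :
    ∑ y, inducedBM ε P₀ P₁ τ P y = 1 := by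
  simp only [inducedBM, induced]
  rw [Finset.sum_comm]
  simp only [← Finset.mul_sum, binaryMechanism_eq, sum_binaryRR, mul_one]
  exact hP.2

lemma inducedBM_zero (ε : ℝ) (P₀ P₁ : A → ℝ) (τ : ℝ) {P : A → ℝ} (hP : P ∈ stdSimplex ℝ A) :
    inducedBM ε P₀ P₁ τ P 0 = 1 - inducedBM ε P₀ P₁ τ P 1 := by
  have := sum_inducedBM ε P₀ P₁ τ hP
  rw [Fin.sum_univ_two] at this
  linarith

lemma channel_mem_Ioo {ε u : ℝ} (hε : 0 < ε) (hu : u ∈ Icc (0 : ℝ) 1) :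
    (1 - tanh (ε / 2)) / 2 + tanh (ε / 2) * u ∈ Ioo (0 : ℝ) 1 := by
  have ht0 := tanh_half_pos hε
  have ht1 := tanh_half_lt_one ε
  have h1 := mul_nonneg ht0.le hu.1
  have h2 := mul_le_mul_of_nonneg_left hu.2 ht0.le
  constructor <;> linarith

lemma inducedBM_one_mem_Ioo {ε : ℝ} (hε : 0 < ε) (P₀ P₁ : A → ℝ) (τ : ℝ) {P : A → ℝ}
    (hP : P ∈ stdSimplex ℝ A) : inducedBM ε P₀ P₁ τ P 1 ∈ Ioo (0 : ℝ) 1 := by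
  classical
  rw [inducedBM_one ε P₀ P₁ τ hP]
  exact channel_mem_Ioo hε (sum_mem_Icc_of_stdSimplex hP _)

lemma inducedBM_pos {ε : ℝ} (hε : 0 < ε) (P₀ P₁ : A → ℝ) (τ : ℝ) {P : A → ℝ}
    (hP : P ∈ stdSimplex ℝ A) (y : Fin 2) : 0 < inducedBM ε P₀ P₁ τ P y := by
  have h := inducedBM_one_mem_Ioo hε P₀ P₁ τ hP
  fin_cases y
  · simpa [inducedBM_zero ε P₀ P₁ τ hP] using h.2
  · exact h.1

end Mechanism

/-! ### Chernoff information as an infimum over exponents -/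

section ChernoffInfo

lemma bernoulliChernoff_pos {p q : ℝ} (hp : p ∈ Ioo (0 : ℝ) 1) (hq : q ∈ Ioo (0 : ℝ) 1)
    (lam : ℝ) : 0 < bernoulliChernoff p q lam := by
  have := hp.1
  have := hq.1
  have := sub_pos.2 hp.2
  have := sub_pos.2 hq.2
  rw [bernoulliChernoff]
  positivity

/-- Needed because a real infimum is a lower bound of its family only if the family is bounded
below. -/
lemma bddBelow_log_bernoulliChernoff {p q : ℝ} (hp : p ∈ Ioo (0 : ℝ) 1) (hq : q ∈ Ioo (0 : ℝ) 1) :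
    BddBelow (range fun lam : Ioo (0 : ℝ) 1 => log (bernoulliChernoff p q lam)) := by
  rw [← range_sigmoid] at hp hq
  obtain ⟨θ₀, rfl⟩ := hp
  obtain ⟨θ₁, rfl⟩ := hq
  refine ⟨-((θ₁ - θ₀) ^ 2 / 32), ?_⟩
  rintro _ ⟨lam, rfl⟩
  have := jensenGap_logPartition_le_sq (θ₀ := θ₀) (θ₁ := θ₁) lam.2
  simp only [bernoulliChernoff, log_sum_rpow_sigmoid]
  linarith

lemma chernoffInfo_eq {Q₀ Q₁ : Fin 2 → ℝ} (h0 : Q₀ 0 = 1 - Q₀ 1) (h1 : Q₁ 0 = 1 - Q₁ 1) :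
    chernoffInfo Q₀ Q₁ =
      -⨅ lam : Ioo (0 : ℝ) 1, log (bernoulliChernoff (Q₀ 1) (Q₁ 1) lam) := by
  simp only [chernoffInfo, Fin.sum_univ_two, h0, h1, bernoulliChernoff, add_comm]

lemma neg_log_le_chernoffInfo {Q₀ Q₁ : Fin 2 → ℝ} (h0 : Q₀ 0 = 1 - Q₀ 1) (h1 : Q₁ 0 = 1 - Q₁ 1)
    (hp : Q₀ 1 ∈ Ioo (0 : ℝ) 1) (hq : Q₁ 1 ∈ Ioo (0 : ℝ) 1) {lam : ℝ} (hl : lam ∈ Ioo (0 : ℝ) 1) :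
    -log (bernoulliChernoff (Q₀ 1) (Q₁ 1) lam) ≤ chernoffInfo Q₀ Q₁ := by
  rw [chernoffInfo_eq h0 h1]
  exact neg_le_neg (ciInf_le (bddBelow_log_bernoulliChernoff hp hq) ⟨lam, hl⟩)

lemma chernoffInfo_le {Q₀ Q₁ : Fin 2 → ℝ} (h0 : Q₀ 0 = 1 - Q₀ 1) (h1 : Q₁ 0 = 1 - Q₁ 1) {c : ℝ}
    (h : ∀ lam ∈ Ioo (0 : ℝ) 1, -log (bernoulliChernoff (Q₀ 1) (Q₁ 1) lam) ≤ c) :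
    chernoffInfo Q₀ Q₁ ≤ c := by
  have : Nonempty (Ioo (0 : ℝ) 1) := ⟨⟨1 / 2, by norm_num, by norm_num⟩⟩
  rw [chernoffInfo_eq h0 h1, neg_le]
  exact le_ciInf fun lam => neg_le.1 (h lam lam.2)

end ChernoffInfo

/-! ### Likelihood-ratio sets and consequences of the optimal threshold -/

section Threshold

variable {A : Type*} [Fintype A]

lemma mem_likelihoodSet {P₀ P₁ : A → ℝ} {τ : ℝ} {x : A} :
    x ∈ likelihoodSet P₀ P₁ τ ↔ τ * P₁ x ≤ P₀ x := by
  simp [likelihoodSet]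

lemma sum_compl_sub_eq [DecidableEq A] {P₀ P₁ : A → ℝ} (hP₀ : P₀ ∈ stdSimplex ℝ A)
    (hP₁ : P₁ ∈ stdSimplex ℝ A) (T : Finset A) :
    ∑ x ∈ Tᶜ, P₁ x - ∑ x ∈ Tᶜ, P₀ x = ∑ x ∈ T, (P₀ x - P₁ x) := by
  have h0 := sum_add_sum_compl_of_stdSimplex hP₀ T
  have h1 := sum_add_sum_compl_of_stdSimplex hP₁ T
  rw [Finset.sum_sub_distrib]
  linarith

lemma two_mul_dTV_eq [DecidableEq A] (P₀ P₁ : A → ℝ) (T : Finset A) :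
    2 * dTV P₀ P₁ = ∑ x ∈ T, |P₀ x - P₁ x| + ∑ x ∈ Tᶜ, |P₀ x - P₁ x| := by
  rw [dTV, Finset.sum_add_sum_compl]
  ring

lemma sum_compl_sub_le_dTV [DecidableEq A] {P₀ P₁ : A → ℝ} (hP₀ : P₀ ∈ stdSimplex ℝ A)
    (hP₁ : P₁ ∈ stdSimplex ℝ A) (T : Finset A) :
    ∑ x ∈ Tᶜ, P₁ x - ∑ x ∈ Tᶜ, P₀ x ≤ dTV P₀ P₁ := by
  have h1 : ∑ x ∈ Tᶜ, P₁ x - ∑ x ∈ Tᶜ, P₀ x ≤ ∑ x ∈ T, |P₀ x - P₁ x| := by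
    rw [sum_compl_sub_eq hP₀ hP₁]
    exact Finset.sum_le_sum fun x _ => le_abs_self _
  have h2 : ∑ x ∈ Tᶜ, P₁ x - ∑ x ∈ Tᶜ, P₀ x ≤ ∑ x ∈ Tᶜ, |P₀ x - P₁ x| := by
    rw [← Finset.sum_sub_distrib]
    exact Finset.sum_le_sum fun x _ => by
      rw [abs_sub_comm]
      exact le_abs_self _
  have := two_mul_dTV_eq P₀ P₁ T
  linarith

lemma sum_abs_eq_of_one_le [DecidableEq A] {P₀ P₁ : A → ℝ} (hP₀ : P₀ ∈ stdSimplex ℝ A)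
    (hP₁ : P₁ ∈ stdSimplex ℝ A) {τ : ℝ} (hτ : 1 ≤ τ) :
    ∑ x ∈ likelihoodSet P₀ P₁ τ, |P₀ x - P₁ x| =
      ∑ x ∈ (likelihoodSet P₀ P₁ τ)ᶜ, P₁ x - ∑ x ∈ (likelihoodSet P₀ P₁ τ)ᶜ, P₀ x := by
  rw [sum_compl_sub_eq hP₀ hP₁]
  refine Finset.sum_congr rfl fun x hx => abs_of_nonneg ?_
  have h1 := mem_likelihoodSet.1 hx
  have h2 := le_mul_of_one_le_left (hP₁.1 x) hτ
  linarith

lemma sum_compl_abs_eq_of_le_one [DecidableEq A] {P₀ P₁ : A → ℝ}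
    (hP₁ : P₁ ∈ stdSimplex ℝ A) {τ : ℝ} (hτ : τ ≤ 1) :
    ∑ x ∈ (likelihoodSet P₀ P₁ τ)ᶜ, |P₀ x - P₁ x| =
      ∑ x ∈ (likelihoodSet P₀ P₁ τ)ᶜ, P₁ x - ∑ x ∈ (likelihoodSet P₀ P₁ τ)ᶜ, P₀ x := by
  rw [← Finset.sum_sub_distrib]
  refine Finset.sum_congr rfl fun x hx => ?_
  have h1 := Finset.mem_compl.1 hx
  rw [mem_likelihoodSet, not_le] at h1
  have h2 := mul_le_of_le_one_left (hP₁.1 x) hτ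
  rw [abs_sub_comm, abs_of_nonneg (by linarith)]

lemma sum_compl_le_sum_compl [DecidableEq A] {P₀ P₁ : A → ℝ} (hP₀ : P₀ ∈ stdSimplex ℝ A)
    (hP₁ : P₁ ∈ stdSimplex ℝ A) (τ : ℝ) :
    ∑ x ∈ (likelihoodSet P₀ P₁ τ)ᶜ, P₀ x ≤ ∑ x ∈ (likelihoodSet P₀ P₁ τ)ᶜ, P₁ x := by
  rw [← sub_nonneg]
  rcases le_total 1 τ with h | h
  · rw [← sum_abs_eq_of_one_le hP₀ hP₁ h]
    positivity
  · rw [← sum_compl_abs_eq_of_le_one hP₁ h]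
    positivity

lemma sum_compl_sub_eq_dTV [DecidableEq A] {P₀ P₁ : A → ℝ} (hP₀ : P₀ ∈ stdSimplex ℝ A)
    (hP₁ : P₁ ∈ stdSimplex ℝ A) :
    ∑ x ∈ (likelihoodSet P₀ P₁ 1)ᶜ, P₁ x - ∑ x ∈ (likelihoodSet P₀ P₁ 1)ᶜ, P₀ x =
      dTV P₀ P₁ := by
  have h := two_mul_dTV_eq P₀ P₁ (likelihoodSet P₀ P₁ 1)
  rw [sum_abs_eq_of_one_le hP₀ hP₁ le_rfl, sum_compl_abs_eq_of_le_one hP₁ le_rfl] at h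
  linarith

/-- For `τ ≥ 1` the difference `P₀ - P₁` is nonnegative on the set, so the sum is the difference of
probabilities, itself at most `dTV`. For `τ ≤ 1` the sign is constant on the complement, and the
total `2 * dTV` gives equality. -/
lemma sum_abs_le [DecidableEq A] {P₀ P₁ : A → ℝ} (hP₀ : P₀ ∈ stdSimplex ℝ A)
    (hP₁ : P₁ ∈ stdSimplex ℝ A) (τ : ℝ) :
    ∑ x ∈ likelihoodSet P₀ P₁ τ, |P₀ x - P₁ x| ≤ 2 * dTV P₀ P₁ -
      (∑ x ∈ (likelihoodSet P₀ P₁ τ)ᶜ, P₁ x - ∑ x ∈ (likelihoodSet P₀ P₁ τ)ᶜ, P₀ x) := by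
  rcases le_total 1 τ with h | h
  · rw [sum_abs_eq_of_one_le hP₀ hP₁ h]
    have := sum_compl_sub_le_dTV hP₀ hP₁ (likelihoodSet P₀ P₁ τ)
    linarith
  · rw [two_mul_dTV_eq P₀ P₁ (likelihoodSet P₀ P₁ τ), sum_compl_abs_eq_of_le_one hP₁ h]
    linarith

lemma dTV_nonneg (P₀ P₁ : A → ℝ) : 0 ≤ dTV P₀ P₁ := by
  rw [dTV]
  positivity

lemma dTV_le_one {P₀ P₁ : A → ℝ} (hP₀ : P₀ ∈ stdSimplex ℝ A) (hP₁ : P₁ ∈ stdSimplex ℝ A) :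
    dTV P₀ P₁ ≤ 1 := by
  classical
  rw [← sum_compl_sub_eq_dTV hP₀ hP₁]
  have h1 := (sum_mem_Icc_of_stdSimplex hP₁ (likelihoodSet P₀ P₁ 1)ᶜ).2
  have h0 := (sum_mem_Icc_of_stdSimplex hP₀ (likelihoodSet P₀ P₁ 1)ᶜ).1
  linarith

lemma tanh_mul_dTV_lt_one {ε : ℝ} (hε : 0 < ε) {P₀ P₁ : A → ℝ} (hP₀ : P₀ ∈ stdSimplex ℝ A)
    (hP₁ : P₁ ∈ stdSimplex ℝ A) : tanh (ε / 2) * dTV P₀ P₁ < 1 := by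
  have := mul_le_of_le_one_right (tanh_half_pos hε).le (dTV_le_one hP₀ hP₁)
  linarith [tanh_half_lt_one ε]

variable {ε : ℝ} {P₀ P₁ : A → ℝ} {τ : ℝ}

/-- The optimal Chernoff information is at least the one of the total variation test. -/
lemma neg_half_log_le_chernoffInfo (hε : 0 < ε) (hP₀ : P₀ ∈ stdSimplex ℝ A)
    (hP₁ : P₁ ∈ stdSimplex ℝ A) (hτ : IsOptimalThreshold ε P₀ P₁ τ) :
    -log (1 - (tanh (ε / 2) * dTV P₀ P₁) ^ 2) / 2 ≤
      chernoffInfo (inducedBM ε P₀ P₁ τ P₀) (inducedBM ε P₀ P₁ τ P₁) := by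
  classical
  refine le_trans ?_ (hτ.2 1 one_pos)
  have hp := inducedBM_one_mem_Ioo hε P₀ P₁ 1 hP₀
  have hq := inducedBM_one_mem_Ioo hε P₀ P₁ 1 hP₁
  refine le_trans ?_ (neg_log_le_chernoffInfo (inducedBM_zero ε P₀ P₁ 1 hP₀)
    (inducedBM_zero ε P₀ P₁ 1 hP₁) hp hq (lam := 1 / 2) (by norm_num))
  have hsub : inducedBM ε P₀ P₁ 1 P₁ 1 - inducedBM ε P₀ P₁ 1 P₀ 1 =
      tanh (ε / 2) * dTV P₀ P₁ := by
    rw [inducedBM_one ε P₀ P₁ 1 hP₀, inducedBM_one ε P₀ P₁ 1 hP₁, ← sum_compl_sub_eq_dTV hP₀ hP₁]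
    ring
  have hpos := bernoulliChernoff_pos hp hq (1 / 2)
  have hle := bernoulliChernoff_half_sq_le (Ioo_subset_Icc_self hp) (Ioo_subset_Icc_self hq)
  rw [hsub] at hle
  have := log_le_log (pow_pos hpos 2) hle
  rw [log_pow] at this
  push_cast at this
  linarith

lemma chernoffInfo_nonneg (hε : 0 < ε) (hP₀ : P₀ ∈ stdSimplex ℝ A)
    (hP₁ : P₁ ∈ stdSimplex ℝ A) (hτ : IsOptimalThreshold ε P₀ P₁ τ) :
    0 ≤ chernoffInfo (inducedBM ε P₀ P₁ τ P₀) (inducedBM ε P₀ P₁ τ P₁) := by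
  refine le_trans ?_ (neg_half_log_le_chernoffInfo hε hP₀ hP₁ hτ)
  have h0 := mul_nonneg (tanh_half_pos hε).le (dTV_nonneg P₀ P₁)
  have h1 := tanh_mul_dTV_lt_one hε hP₀ hP₁
  have := log_nonpos (x := 1 - (tanh (ε / 2) * dTV P₀ P₁) ^ 2) (by nlinarith) (by nlinarith)
  linarith

lemma cTildeB_sq_div_sB_sq_le_chernoffInfo (hε : 0 < ε) (hP₀ : P₀ ∈ stdSimplex ℝ A)
    (hP₁ : P₁ ∈ stdSimplex ℝ A) (hτ : IsOptimalThreshold ε P₀ P₁ τ) :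
    cTildeB ε P₀ P₁ τ ^ 2 / sB ε P₀ P₁ ^ 2 ≤
      chernoffInfo (inducedBM ε P₀ P₁ τ P₀) (inducedBM ε P₀ P₁ τ P₁) := by
  classical
  have hI := chernoffInfo_nonneg hε hP₀ hP₁ hτ
  -- This also covers `sB = 0`, where the quotient is `0` and `I ≥ 0` suffices.
  refine div_le_of_le_mul₀ (sq_nonneg _) hI ?_
  have ht0 := tanh_half_pos hε
  have hp := inducedBM_one_mem_Ioo hε P₀ P₁ τ hP₀
  have hq := inducedBM_one_mem_Ioo hε P₀ P₁ τ hP₁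
  have hsub : inducedBM ε P₀ P₁ τ P₁ 1 - inducedBM ε P₀ P₁ τ P₀ 1 =
      tanh (ε / 2) * (∑ x ∈ (likelihoodSet P₀ P₁ τ)ᶜ, P₁ x -
        ∑ x ∈ (likelihoodSet P₀ P₁ τ)ᶜ, P₀ x) := by
    rw [inducedBM_one ε P₀ P₁ τ hP₀, inducedBM_one ε P₀ P₁ τ hP₁]
    ring
  have hle1 := sum_compl_le_sum_compl hP₀ hP₁ 1
  have hle := sum_compl_le_sum_compl hP₀ hP₁ τ
  have hrange : logOddsRatio (inducedBM ε P₀ P₁ τ P₀ 1) (inducedBM ε P₀ P₁ τ P₁ 1) ≤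
      sB ε P₀ P₁ := by
    rw [inducedBM_one ε P₀ P₁ τ hP₀, inducedBM_one ε P₀ P₁ τ hP₁]
    exact logOddsRatio_channel_le_sB hε hP₀ hP₁ _ hle
  have hrange1 : 2 * log ((1 + tanh (ε / 2) * dTV P₀ P₁) / (1 - tanh (ε / 2) * dTV P₀ P₁)) ≤
      sB ε P₀ P₁ := by
    refine le_trans ?_ (logOddsRatio_channel_le_sB hε hP₀ hP₁ _ hle1)
    have := two_mul_log_le_logOddsRatio
      (channel_mem_Ioo hε (sum_mem_Icc_of_stdSimplex hP₀ (likelihoodSet P₀ P₁ 1)ᶜ)).1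
      (by gcongr) (channel_mem_Ioo hε (sum_mem_Icc_of_stdSimplex hP₁ (likelihoodSet P₀ P₁ 1)ᶜ)).2
    rwa [add_sub_add_left_eq_sub, ← mul_sub, sum_compl_sub_eq_dTV hP₀ hP₁] at this
  have key := chernoff_mul_sq_ge hp.1
    (by rw [← sub_nonneg, hsub]; exact mul_nonneg ht0.le (sub_nonneg.2 hle)) hq.2
    (mul_nonneg ht0.le (dTV_nonneg P₀ P₁)) (tanh_mul_dTV_lt_one hε hP₀ hP₁)
    (by
      rw [hsub]
      exact mul_le_mul_of_nonneg_left (sum_compl_sub_le_dTV hP₀ hP₁ _) ht0.le)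
    (neg_half_log_le_chernoffInfo hε hP₀ hP₁ hτ)
    (fun c hc => chernoffInfo_le (inducedBM_zero ε P₀ P₁ τ hP₀) (inducedBM_zero ε P₀ P₁ τ hP₁) hc)
    hrange hrange1
  refine le_trans ?_ key
  rw [hsub]
  set t := tanh (ε / 2)
  have hS := mul_le_mul_of_nonneg_left (sum_abs_le hP₀ hP₁ τ) ht0.le
  have hS0 : 0 ≤ t * ∑ x ∈ likelihoodSet P₀ P₁ τ, |P₀ x - P₁ x| := by positivity
  have h4 := pow_le_pow_left₀ hS0 hS 4
  rw [cTildeB]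
  calc _ = 4 * (t * ∑ x ∈ likelihoodSet P₀ P₁ τ, |P₀ x - P₁ x|) ^ 4 := by ring
    _ ≤ _ := mul_le_mul_of_nonneg_left h4 (by norm_num)
    _ = _ := by ring

end Threshold

end BMCPD

namespace BMCPD

open Set

/-! ### A maximal inequality by recursion on words -/

section Crossing

variable {B : Type*}

/-- The words whose multiplicative walk with steps `z`, started in `c`, is at least `1` at some
time in `[m, N]`. -/
def crossingSet (z : B → ℝ) (N m : ℕ) (c : ℝ) : Set (Fin N → B) :=
  {y | ∃ j, m ≤ j ∧ j ≤ N ∧ 1 ≤ c * ∏ r : Fin N, if (r : ℕ) < j then z (y r) else 1}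

lemma cons_mem_crossingSet_succ {z : B → ℝ} {N m : ℕ} {c : ℝ} {b : B} {y : Fin N → B} :
    (Fin.cons b y : Fin (N + 1) → B) ∈ crossingSet z (N + 1) (m + 1) c ↔
      y ∈ crossingSet z N m (c * z b) := by
  have h : ∀ j, c * ∏ r : Fin (N + 1), (if (r : ℕ) < j + 1 then
      z ((Fin.cons b y : Fin (N + 1) → B) r) else 1) =
      c * z b * ∏ r : Fin N, if (r : ℕ) < j then z (y r) else 1 := by
    intro j
    rw [Fin.prod_univ_succ]
    simp [mul_assoc]
  constructor
  · rintro ⟨j, h1, h2, h3⟩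
    obtain ⟨j, rfl⟩ : ∃ i, j = i + 1 := ⟨j - 1, by omega⟩
    rw [h] at h3
    exact ⟨j, by omega, by omega, h3⟩
  · rintro ⟨j, h1, h2, h3⟩
    refine ⟨j + 1, by omega, by omega, ?_⟩
    rw [h]
    exact h3

lemma crossingSet_zero_eq {z : B → ℝ} {N : ℕ} {c : ℝ} (hc : c < 1) :
    crossingSet z N 0 c = crossingSet z N 1 c := by
  ext y
  constructor
  · rintro ⟨j, h1, h2, h3⟩
    rcases Nat.eq_zero_or_pos j with rfl | hj
    · simp at h3
      linarith
    · exact ⟨j, hj, h2, h3⟩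
  · rintro ⟨j, h1, h2, h3⟩
    exact ⟨j, by omega, h2, h3⟩

lemma sum_cons [Fintype B] {N : ℕ} (f : (Fin (N + 1) → B) → ℝ) :
    ∑ y, f y = ∑ b, ∑ y : Fin N → B, f (Fin.cons b y) := by
  rw [← (Fin.consEquiv fun _ => B).sum_comp, Fintype.sum_prod_type]
  rfl

lemma sum_prod_eq_one [Fintype B] {w : B → ℝ} (hw1 : ∑ b, w b = 1) (N : ℕ) :
    ∑ y : Fin N → B, ∏ r, w (y r) = 1 := by
  classical
  rw [← Fintype.piFinset_univ, Finset.sum_prod_piFinset]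
  simp [hw1]

/-- The maximal inequality for the nonnegative supermartingale `c * ∏ z (yᵣ)` of a word with
independent letters of law `w`. -/
lemma sum_indicator_crossingSet_le [Fintype B] {w z : B → ℝ} (hw : ∀ b, 0 ≤ w b)
    (hz : ∀ b, 0 ≤ z b) (hw1 : ∑ b, w b = 1) (hg : ∑ b, w b * z b ≤ 1) (N : ℕ) :
    ∀ (m : ℕ) (c : ℝ), 0 ≤ c →
      ∑ y, (crossingSet z N m c).indicator (fun y => ∏ r, w (y r)) y ≤
        c * (∑ b, w b * z b) ^ m := by
  set g := ∑ b, w b * z b with hgdef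
  have hg0 : 0 ≤ g := Finset.sum_nonneg fun b _ => mul_nonneg (hw b) (hz b)
  have htotal : ∀ (N m : ℕ) (c : ℝ),
      ∑ y, (crossingSet z N m c).indicator (fun y => ∏ r, w (y r)) y ≤ 1 := by
    intro N m c
    rw [← sum_prod_eq_one hw1 N]
    exact Finset.sum_le_sum fun y _ => indicator_le_self' (fun y _ =>
      Finset.prod_nonneg fun r _ => hw _) y
  induction N with
  | zero =>
    intro m c hc
    by_cases h : m = 0 ∧ 1 ≤ c
    · rw [h.1, pow_zero, mul_one]
      exact (htotal 0 0 c).trans h.2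
    · have he : crossingSet z 0 m c = ∅ := by
        ext y
        simp only [mem_empty_iff_false, iff_false]
        rintro ⟨j, h1, h2, h3⟩
        refine h ⟨by omega, ?_⟩
        simpa using h3
      rw [he]
      simp only [indicator_empty, Finset.sum_const_zero]
      positivity
  | succ N ih =>
    have hsucc : ∀ (m : ℕ) (c : ℝ), 0 ≤ c →
        ∑ y, (crossingSet z (N + 1) (m + 1) c).indicator (fun y => ∏ r, w (y r)) y ≤
          c * g ^ (m + 1) := by
      intro m c hc
      rw [sum_cons]
      calc _ = ∑ b, w b * ∑ y, (crossingSet z N m (c * z b)).indicator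
              (fun y => ∏ r, w (y r)) y := by
            refine Finset.sum_congr rfl fun b _ => ?_
            rw [Finset.mul_sum]
            refine Finset.sum_congr rfl fun y _ => ?_
            by_cases h : y ∈ crossingSet z N m (c * z b)
            · rw [indicator_of_mem h, indicator_of_mem (cons_mem_crossingSet_succ.2 h),
                Fin.prod_univ_succ]
              simp
            · rw [indicator_of_notMem h,
                indicator_of_notMem (fun h' => h (cons_mem_crossingSet_succ.1 h')), mul_zero]
        _ ≤ ∑ b, w b * (c * z b * g ^ m) := by
            gcongr with b
            · exact hw b
            · exact ih m _ (mul_nonneg hc (hz b))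
        _ = c * (∑ b, w b * z b) * g ^ m := by
            rw [Finset.mul_sum, Finset.sum_mul]
            exact Finset.sum_congr rfl fun b _ => by ring
        _ = c * g ^ (m + 1) := by rw [← hgdef]; ring
    intro m c hc
    rcases m with _ | m
    · rcases le_or_gt 1 c with h | h
      · rw [pow_zero, mul_one]
        exact (htotal _ _ c).trans h
      · rw [crossingSet_zero_eq h]
        refine (hsucc 0 c hc).trans ?_
        simp only [zero_add, pow_one, pow_zero]
        gcongr
    · exact hsucc m c hc

end Crossing

/-! ### From independent samples to sums over words, and uniform Chernoff bounds -/

section Sample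

variable {Ω B : Type*} [MeasurableSpace Ω] [MeasurableSpace B] [MeasurableSingletonClass B]
  [Fintype B] {μ : Measure Ω} [IsProbabilityMeasure μ]

/-- A union bound over words; subadditivity avoids any measurability requirement on the event. -/
lemma measureReal_tuple_mem_le {N : ℕ} {Y : Fin N → Ω → B} (hY : iIndepFun Y μ)
    {w : B → ℝ} (hlaw : ∀ i y, μ.real {ω | Y i ω = y} = w y) (E : Set (Fin N → B)) :
    μ.real {ω | (fun i => Y i ω) ∈ E} ≤ ∑ y, E.indicator (fun y => ∏ i, w (y i)) y := by
  classical
  have hprod : ∀ y : Fin N → B, μ.real {ω | ∀ i, Y i ω = y i} = ∏ i, w (y i) := by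
    intro y
    have h := hY.measure_inter_preimage_eq_mul Finset.univ (sets := fun i => {y i})
      (fun i _ => measurableSet_singleton _)
    have e : {ω | ∀ i, Y i ω = y i} = ⋂ i ∈ Finset.univ, Y i ⁻¹' {y i} := by
      ext ω; simp
    rw [measureReal_def, e, h, ENNReal.toReal_prod]
    exact Finset.prod_congr rfl fun i _ => hlaw i (y i)
  have e : {ω | (fun i => Y i ω) ∈ E} ⊆
      ⋃ y ∈ Finset.univ.filter (· ∈ E), {ω | ∀ i, Y i ω = y i} := by
    intro ω hω
    simp only [mem_iUnion]
    exact ⟨fun i => Y i ω, by simpa using hω, fun i => rfl⟩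
  calc _ ≤ μ.real (⋃ y ∈ Finset.univ.filter (· ∈ E), {ω | ∀ i, Y i ω = y i}) :=
        measureReal_mono e (measure_ne_top _ _)
    _ ≤ ∑ y ∈ Finset.univ.filter (· ∈ E), μ.real {ω | ∀ i, Y i ω = y i} :=
        measureReal_biUnion_finset_le _ _
    _ = _ := by
        rw [Finset.sum_filter]
        refine Finset.sum_congr rfl fun y _ => ?_
        rw [hprod, indicator_apply]

end Sample

end BMCPD

namespace BMCPD

open Real Set

section Walk

variable {Ω B : Type*} [MeasurableSpace Ω] [MeasurableSpace B] [MeasurableSingletonClass B]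
  [Fintype B] {μ : Measure Ω} [IsProbabilityMeasure μ]

/-- A Chernoff bound, uniform in time, for a random walk with independent steps `l (Zᵣ)`. -/
lemma measureReal_exists_sum_nonneg_le {N : ℕ} {Z : Fin N → Ω → B} (hZ : iIndepFun Z μ)
    {w l : B → ℝ} (hlaw : ∀ i y, μ.real {ω | Z i ω = y} = w y) (hw : ∀ b, 0 ≤ w b)
    (hw1 : ∑ b, w b = 1) {s : ℝ} (hs : 0 ≤ s) (hg : ∑ b, w b * exp (s * l b) ≤ 1) (m : ℕ) :
    μ.real {ω | ∃ j, m ≤ j ∧ j ≤ N ∧ 0 ≤ ∑ r : Fin N, if (r : ℕ) < j then l (Z r ω) else 0} ≤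
      (∑ b, w b * exp (s * l b)) ^ m := by
  refine le_trans (measureReal_mono (fun ω => ?_) (measure_ne_top _ _))
    ((measureReal_tuple_mem_le hZ hlaw (crossingSet (fun b => exp (s * l b)) N m 1)).trans
      ((sum_indicator_crossingSet_le hw (fun b => (exp_pos _).le) hw1 hg N m 1
        zero_le_one).trans (one_mul _).le))
  rintro ⟨j, h1, h2, h3⟩
  refine ⟨j, h1, h2, ?_⟩
  have e : ∏ r : Fin N, (if (r : ℕ) < j then exp (s * l (Z r ω)) else 1) =
      exp (s * ∑ r : Fin N, if (r : ℕ) < j then l (Z r ω) else 0) := by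
    rw [Finset.mul_sum, exp_sum]
    refine Finset.prod_congr rfl fun r _ => ?_
    split_ifs <;> simp
  rw [one_mul, e]
  exact one_le_exp (mul_nonneg hs h3)

end Walk

/-! ### The log-likelihood ratio as two walks away from the change-point -/

section LogLR

variable {B : Type*} {n : ℕ} {Q₀ Q₁ : B → ℝ}

lemma logLR_sub_logLR {y : Fin n → B} {k k' : ℕ} (h : k ≤ k') :
    logLR Q₀ Q₁ y k - logLR Q₀ Q₁ y k' =
      ∑ i ∈ Finset.univ.filter (fun i : Fin n => k ≤ (i : ℕ) + 1 ∧ (i : ℕ) + 1 < k'),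
        log (Q₁ (y i) / Q₀ (y i)) := by
  rw [logLR, logLR, ← Finset.sum_sub_distrib, Finset.sum_filter]
  refine Finset.sum_congr rfl fun i _ => ?_
  by_cases h1 : k ≤ (i : ℕ) + 1 <;> by_cases h2 : k' ≤ (i : ℕ) + 1
  · simp [h1, h2, not_lt.2 h2]
  · simp [h1, h2, not_le.1 h2]
  · omega
  · simp [h1, h2]

/-- The index of the `r`-th sample before the change-point. -/
def indexBefore {kstar : ℕ} (hk : kstar ∈ Ioc 1 n) (r : Fin (kstar - 1)) : Fin n :=
  ⟨kstar - 2 - r, by have := hk.1; have := hk.2; omega⟩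

/-- The index of the `r`-th sample from the change-point on. -/
def indexAfter {kstar : ℕ} (hk : kstar ∈ Ioc 1 n) (r : Fin (n - kstar + 1)) : Fin n :=
  ⟨kstar - 1 + r, by have := hk.1; have := hk.2; omega⟩

lemma indexBefore_injective {kstar : ℕ} (hk : kstar ∈ Ioc 1 n) :
    Function.Injective (indexBefore hk) := by
  intro r s h
  have := hk.1
  simp only [indexBefore, Fin.mk.injEq] at h
  ext
  omega

lemma indexAfter_injective {kstar : ℕ} (hk : kstar ∈ Ioc 1 n) :
    Function.Injective (indexAfter hk) := by
  intro r s h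
  simp only [indexAfter, Fin.mk.injEq] at h
  ext
  omega

lemma logLR_sub_eq_sum_before {kstar : ℕ} (hk : kstar ∈ Ioc 1 n) (y : Fin n → B) {k : ℕ}
    (hkk : k ≤ kstar) :
    logLR Q₀ Q₁ y k - logLR Q₀ Q₁ y kstar =
      ∑ r : Fin (kstar - 1), if (r : ℕ) < kstar - k then
        log (Q₁ (y (indexBefore hk r)) / Q₀ (y (indexBefore hk r))) else 0 := by
  obtain ⟨h1, h2⟩ := hk
  rw [logLR_sub_logLR hkk, ← Finset.sum_filter]
  refine Finset.sum_nbij' (fun i => ⟨kstar - 2 - i, by omega⟩) (indexBefore ⟨h1, h2⟩) ?_ ?_ ?_ ?_ ?_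
  · intro i hi
    simp only [Finset.mem_filter, Finset.mem_univ, true_and] at hi ⊢
    omega
  · intro r hr
    simp only [Finset.mem_filter, Finset.mem_univ, true_and, indexBefore] at hr ⊢
    omega
  · intro i hi
    simp only [Finset.mem_filter, Finset.mem_univ, true_and] at hi
    ext
    simp only [indexBefore]
    omega
  · intro r hr
    simp only [Finset.mem_filter, Finset.mem_univ, true_and] at hr
    ext
    simp only [indexBefore]
    omega
  · intro i hi
    simp only [Finset.mem_filter, Finset.mem_univ, true_and] at hi
    have : indexBefore ⟨h1, h2⟩ ⟨kstar - 2 - i, by omega⟩ = i := by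
      ext
      simp only [indexBefore]
      omega
    rw [this]

lemma logLR_sub_eq_sum_after {kstar : ℕ} (hk : kstar ∈ Ioc 1 n) (y : Fin n → B) {k : ℕ}
    (hkk : kstar ≤ k) (hkn : k ≤ n) :
    logLR Q₀ Q₁ y kstar - logLR Q₀ Q₁ y k =
      ∑ r : Fin (n - kstar + 1), if (r : ℕ) < k - kstar then
        log (Q₁ (y (indexAfter hk r)) / Q₀ (y (indexAfter hk r))) else 0 := by
  obtain ⟨h1, h2⟩ := hk
  rw [logLR_sub_logLR hkk, ← Finset.sum_filter]
  refine Finset.sum_nbij' (fun i => ⟨i - (kstar - 1), by omega⟩) (indexAfter ⟨h1, h2⟩) ?_ ?_ ?_ ?_ ?_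
  · intro i hi
    simp only [Finset.mem_filter, Finset.mem_univ, true_and] at hi ⊢
    omega
  · intro r hr
    simp only [Finset.mem_filter, Finset.mem_univ, true_and, indexAfter] at hr ⊢
    omega
  · intro i hi
    simp only [Finset.mem_filter, Finset.mem_univ, true_and] at hi
    ext
    simp only [indexAfter]
    omega
  · intro r hr
    ext
    simp only [indexAfter]
    omega
  · intro i hi
    simp only [Finset.mem_filter, Finset.mem_univ, true_and] at hi
    have : indexAfter ⟨h1, h2⟩ ⟨i - (kstar - 1), by omega⟩ = i := by
      ext
      simp only [indexAfter]
      omega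
    rw [this]

end LogLR

section Sample

lemma IsPrivatizedSample.iIndepFun_Y {Ω A B : Type*} [MeasurableSpace Ω] [MeasurableSpace A]
    [MeasurableSpace B] {μ : Measure Ω} {n kstar : ℕ} {P₀ P₁ : A → ℝ} {W : A → B → ℝ}
    {X : Fin n → Ω → A} {Y : Fin n → Ω → B} (h : IsPrivatizedSample μ P₀ P₁ W kstar X Y) :
    iIndepFun Y μ :=
  h.indep.comp (fun _ => Prod.snd) fun _ => measurable_snd

variable {Ω A B : Type*} [MeasurableSpace Ω] [MeasurableSpace A] [MeasurableSingletonClass A]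
  [MeasurableSpace B] [MeasurableSingletonClass B] [Fintype A]
  {μ : Measure Ω} [IsProbabilityMeasure μ] {n kstar : ℕ} {P₀ P₁ : A → ℝ} {W : A → B → ℝ}
  {X : Fin n → Ω → A} {Y : Fin n → Ω → B}

lemma IsPrivatizedSample.law_Y (h : IsPrivatizedSample μ P₀ P₁ W kstar X Y) (i : Fin n) (y : B) :
    μ.real {ω | Y i ω = y} = induced (if (i : ℕ) + 1 < kstar then P₀ else P₁) W y := by
  have e : {ω | Y i ω = y} = ⋃ x ∈ Finset.univ, {ω | X i ω = x ∧ Y i ω = y} := by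
    ext ω; simp
  rw [e, measureReal_biUnion_finset]
  · rw [induced]
    refine Finset.sum_congr rfl fun x _ => ?_
    rw [h.law]
    split_ifs <;> rfl
  · intro x _ x' _ hne
    refine Set.disjoint_left.2 fun ω h1 h2 => hne ?_
    rw [← h1.1, h2.1]
  · exact fun x _ => (h.measurable_X i (measurableSet_singleton x)).inter
      (h.measurable_Y i (measurableSet_singleton y))

end Sample

/-! ### Error probability of the algorithm -/

section Algorithm

lemma bernoulliChernoff_le_one {p q lam : ℝ} (hp : p ∈ Icc (0 : ℝ) 1) (hq : q ∈ Icc (0 : ℝ) 1)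
    (hl : lam ∈ Ioo (0 : ℝ) 1) : bernoulliChernoff p q lam ≤ 1 := by
  have h1 := geom_mean_le_arith_mean2_weighted hl.1.le (sub_nonneg.2 hl.2.le) hp.1 hq.1 (by ring)
  have h2 := geom_mean_le_arith_mean2_weighted hl.1.le (sub_nonneg.2 hl.2.le)
    (sub_nonneg.2 hp.2) (sub_nonneg.2 hq.2) (by ring)
  rw [bernoulliChernoff]
  linarith

lemma mul_exp_mul_log_div {a b s : ℝ} (ha : 0 < a) (hb : 0 < b) :
    a * exp (s * log (b / a)) = a ^ (1 - s) * b ^ s := by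
  rw [mul_comm s, exp_mul, exp_log (by positivity), div_rpow hb.le ha.le, rpow_sub ha, rpow_one]
  ring

/-- The moment generating function of the log-likelihood ratio under `Q₀` at `1 - λ`. Under `Q₁` at
`-λ` it takes the same value, so early and late errors share one rate. -/
lemma sum_mul_exp_eq_bernoulliChernoff {Q₀ Q₁ : Fin 2 → ℝ} (h0 : ∀ y, 0 < Q₀ y)
    (h1 : ∀ y, 0 < Q₁ y) (hs0 : Q₀ 0 = 1 - Q₀ 1) (hs1 : Q₁ 0 = 1 - Q₁ 1) (lam : ℝ) :
    ∑ y, Q₀ y * exp ((1 - lam) * log (Q₁ y / Q₀ y)) = bernoulliChernoff (Q₀ 1) (Q₁ 1) lam := by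
  simp only [mul_exp_mul_log_div (h0 _) (h1 _), sub_sub_cancel, Fin.sum_univ_two,
    bernoulliChernoff, hs0, hs1, add_comm]

lemma sum_mul_exp_neg_eq_bernoulliChernoff {Q₀ Q₁ : Fin 2 → ℝ} (h0 : ∀ y, 0 < Q₀ y)
    (h1 : ∀ y, 0 < Q₁ y) (hs0 : Q₀ 0 = 1 - Q₀ 1) (hs1 : Q₁ 0 = 1 - Q₁ 1) (lam : ℝ) :
    ∑ y, Q₁ y * exp (lam * -log (Q₁ y / Q₀ y)) = bernoulliChernoff (Q₀ 1) (Q₁ 1) lam := by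
  simp only [← log_inv, inv_div, mul_exp_mul_log_div (h1 _) (h0 _), Fin.sum_univ_two,
    bernoulliChernoff, hs0, hs1, add_comm, mul_comm]

variable {Ω A : Type*} [MeasurableSpace Ω] [Fintype A] [MeasurableSpace A]
  [MeasurableSingletonClass A] {μ : Measure Ω} [IsProbabilityMeasure μ] {P₀ P₁ : A → ℝ}
  {ε : ℝ} {n kstar : ℕ} {τ : ℝ} {X : Fin n → Ω → A} {Y : Fin n → Ω → Fin 2} {khat : Ω → ℕ}

/-- Comparing the maximizer with `kstar` makes the walk between them nonnegative. Early errors use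
the reversed walk under `Q₀`, late ones the forward walk of negated steps under `Q₁`. -/
lemma measureReal_error_le_bernoulliChernoff (hP₀ : P₀ ∈ stdSimplex ℝ A)
    (hP₁ : P₁ ∈ stdSimplex ℝ A) (hε : 0 < ε) (hk : kstar ∈ Ioc 1 n)
    (hrun : IsOfflineBMCPD μ ε P₀ P₁ kstar τ X Y khat) (α : ℕ) {lam : ℝ}
    (hl : lam ∈ Ioo (0 : ℝ) 1) :
    μ.real {ω | (khat ω : ℤ) ∉ Icc ((kstar : ℤ) - α) ((kstar : ℤ) + α)} ≤
      2 * bernoulliChernoff (inducedBM ε P₀ P₁ τ P₀ 1) (inducedBM ε P₀ P₁ τ P₁ 1) lam ^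
        (α + 1) := by
  set Q₀ := inducedBM ε P₀ P₁ τ P₀ with hQ₀
  set Q₁ := inducedBM ε P₀ P₁ τ P₁ with hQ₁
  have hpos0 : ∀ y, 0 < Q₀ y := inducedBM_pos hε P₀ P₁ τ hP₀
  have hpos1 : ∀ y, 0 < Q₁ y := inducedBM_pos hε P₀ P₁ τ hP₁
  have hs0 : Q₀ 0 = 1 - Q₀ 1 := inducedBM_zero ε P₀ P₁ τ hP₀
  have hs1 : Q₁ 0 = 1 - Q₁ 1 := inducedBM_zero ε P₀ P₁ τ hP₁
  have hg := bernoulliChernoff_le_one (Ioo_subset_Icc_self (inducedBM_one_mem_Ioo hε P₀ P₁ τ hP₀))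
    (Ioo_subset_Icc_self (inducedBM_one_mem_Ioo hε P₀ P₁ τ hP₁)) hl
  have hindep := hrun.sample.iIndepFun_Y
  have hbefore := measureReal_exists_sum_nonneg_le (μ := μ)
    (iIndepFun.precomp (g := indexBefore hk) (indexBefore_injective hk) hindep) (w := Q₀) (l := fun y => log (Q₁ y / Q₀ y))
    (fun r y => by
      rw [hrun.sample.law_Y, if_pos]
      · rfl
      · have := hk.1
        simp only [indexBefore]
        omega)
    (fun y => (hpos0 y).le) (sum_inducedBM ε P₀ P₁ τ hP₀) (s := 1 - lam) (sub_nonneg.2 hl.2.le)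
    (by rwa [sum_mul_exp_eq_bernoulliChernoff hpos0 hpos1 hs0 hs1]) (α + 1)
  have hafter := measureReal_exists_sum_nonneg_le (μ := μ)
    (iIndepFun.precomp (g := indexAfter hk) (indexAfter_injective hk) hindep) (w := Q₁) (l := fun y => -log (Q₁ y / Q₀ y))
    (fun r y => by
      rw [hrun.sample.law_Y, if_neg]
      · rfl
      · have := hk.1
        simp only [indexAfter]
        omega)
    (fun y => (hpos1 y).le) (sum_inducedBM ε P₀ P₁ τ hP₁) (s := lam) hl.1.le
    (by rwa [sum_mul_exp_neg_eq_bernoulliChernoff hpos0 hpos1 hs0 hs1]) (α + 1)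
  rw [sum_mul_exp_eq_bernoulliChernoff hpos0 hpos1 hs0 hs1] at hbefore
  rw [sum_mul_exp_neg_eq_bernoulliChernoff hpos0 hpos1 hs0 hs1] at hafter
  rw [two_mul]
  refine le_trans (le_trans (measureReal_mono (fun ω hω => ?_) (measure_ne_top _ _))
    (measureReal_union_le _ _)) (add_le_add hbefore hafter)
  obtain ⟨hmem, hmax⟩ := hrun.estimate ω
  obtain ⟨hk1, hkn⟩ := Finset.mem_Icc.1 hmem
  have hle := hmax kstar (Finset.mem_Icc.2 ⟨hk.1.le, hk.2⟩)
  rw [← sub_nonneg] at hle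
  -- Missing the closed integer window means a distance of at least `α + 1`.
  have hω' : khat ω + (α + 1) ≤ kstar ∨ kstar + (α + 1) ≤ khat ω := by
    by_contra hcon
    refine hω ⟨?_, ?_⟩ <;> omega
  rcases hω' with h | h
  · left
    refine ⟨kstar - khat ω, by omega, by omega, ?_⟩
    rwa [logLR_sub_eq_sum_before hk _ (by omega)] at hle
  · right
    refine ⟨khat ω - kstar, by omega, by omega, ?_⟩
    rw [← neg_sub, logLR_sub_eq_sum_after hk _ (by omega) hkn, ← Finset.sum_neg_distrib] at hle
    refine hle.trans_eq (Finset.sum_congr rfl fun r _ => ?_)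
    split_ifs
    · rfl
    · exact neg_zero

/-- The error probability decays at the rate of the Chernoff information. -/
lemma measureReal_error_le_exp_chernoffInfo (hP₀ : P₀ ∈ stdSimplex ℝ A)
    (hP₁ : P₁ ∈ stdSimplex ℝ A) (hε : 0 < ε) (hk : kstar ∈ Ioc 1 n)
    (hrun : IsOfflineBMCPD μ ε P₀ P₁ kstar τ X Y khat) (α : ℕ) :
    μ.real {ω | (khat ω : ℤ) ∉ Icc ((kstar : ℤ) - α) ((kstar : ℤ) + α)} ≤
      2 * exp (-((α + 1) *
        chernoffInfo (inducedBM ε P₀ P₁ τ P₀) (inducedBM ε P₀ P₁ τ P₁))) := by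
  set β := μ.real {ω | (khat ω : ℤ) ∉ Icc ((kstar : ℤ) - α) ((kstar : ℤ) + α)} with hβ
  have hβ0 : 0 ≤ β := measureReal_nonneg
  rcases hβ0.eq_or_lt with h0 | h0
  · rw [← h0]
    positivity
  have hα : (0 : ℝ) < α + 1 := by positivity
  -- Solving the bound for each exponent before taking the supremum avoids having to attain an
  -- optimal exponent; `β = 0` was split off to make the logarithm usable.
  have hI : chernoffInfo (inducedBM ε P₀ P₁ τ P₀) (inducedBM ε P₀ P₁ τ P₁) ≤
      -log (β / 2) / (α + 1) := by
    refine chernoffInfo_le (inducedBM_zero ε P₀ P₁ τ hP₀) (inducedBM_zero ε P₀ P₁ τ hP₁)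
      fun lam hl => ?_
    have h := measureReal_error_le_bernoulliChernoff hP₀ hP₁ hε hk hrun α hl
    rw [← hβ] at h
    have h2 := log_le_log (by positivity) ((div_le_iff₀' two_pos).2 h)
    rw [log_pow] at h2
    push_cast at h2
    rw [le_div_iff₀ hα]
    linarith
  rw [le_div_iff₀ hα] at hI
  have h3 : log (β / 2) ≤ -((α + 1) *
      chernoffInfo (inducedBM ε P₀ P₁ τ P₀) (inducedBM ε P₀ P₁ τ P₁)) := by linarith
  rw [log_le_iff_le_exp (by positivity)] at h3
  linarith

end Algorithm

end BMCPD

theorem theorem5p10 {Ω A : Type*} [MeasurableSpace Ω] [Fintype A] [MeasurableSpace A]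
    [MeasurableSingletonClass A] (μ : MeasureTheory.Measure Ω)
    [MeasureTheory.IsProbabilityMeasure μ]
    (P₀ P₁ : A → ℝ) (hP₀ : P₀ ∈ stdSimplex ℝ A) (hP₁ : P₁ ∈ stdSimplex ℝ A)
    (ε : ℝ) (hε : 0 < ε) (n kstar : ℕ) (hk : kstar ∈ Set.Ioc 1 n) (τ : ℝ)
    (X : Fin n → Ω → A) (Y : Fin n → Ω → Fin 2) (khat : Ω → ℕ)
    (hrun : BMCPD.IsOfflineBMCPD μ ε P₀ P₁ kstar τ X Y khat) :
    BMCPD.IsLDP ε (BMCPD.binaryMechanism ε P₀ P₁ τ) ∧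
    ∀ α : ℕ, α ∈ Set.Icc 1 n → ∃ β : ℝ, BMCPD.IsAccurate μ kstar khat α β ∧
      β ≤ 2 * min
        (∑ i ∈ Finset.Icc 1 (BMCPD.iStar n α),
          Real.exp (-((2 : ℝ) ^ (i - 1) * α * BMCPD.cTildeB ε P₀ P₁ τ ^ 2
            / BMCPD.sB ε P₀ P₁ ^ 2)))
        ((1 - BMCPD.cB ε P₀ P₁ / 2) ^ ((α : ℝ) / 2)) := by
  refine ⟨BMCPD.isLDP_binaryMechanism hε.le P₀ P₁ τ, fun α hα => ⟨_, rfl, ?_⟩⟩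
  have hI0 := BMCPD.chernoffInfo_nonneg hε hP₀ hP₁ hrun.optimal
  have hIs := BMCPD.cTildeB_sq_div_sB_sq_le_chernoffInfo hε hP₀ hP₁ hrun.optimal
  have hIc := BMCPD.neg_half_log_le_chernoffInfo hε hP₀ hP₁ hrun.optimal
  have herr := BMCPD.measureReal_error_le_exp_chernoffInfo hP₀ hP₁ hε hk hrun α
  set I := BMCPD.chernoffInfo (BMCPD.inducedBM ε P₀ P₁ τ P₀) (BMCPD.inducedBM ε P₀ P₁ τ P₁)
  have hα1 : (1 : ℝ) ≤ α := by exact_mod_cast hα.1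
  have hexp : Real.exp (-((α + 1) * I)) ≤ Real.exp (-(α * I)) := by
    apply Real.exp_le_exp.2
    linarith
  rw [mul_min_of_nonneg _ _ zero_le_two]
  refine le_min ?_ ?_
  -- With an empty sum the error must vanish: then `n ≤ α + 1`, and since `kstar` and `khat` both
  -- lie in `{1, …, n}`, they differ by at most `α`.
  · rcases Nat.eq_zero_or_pos (BMCPD.iStar n α) with hi | hi
    · have hn1 : (0 : ℝ) < (n : ℝ) - 1 := by
        have : 1 < n := hk.1.trans_le hk.2
        have : (1 : ℝ) < n := by exact_mod_cast this
        linarith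
      have hnα : n ≤ α + 1 := by
        rw [BMCPD.iStar, Nat.ceil_eq_zero, Real.logb_nonpos_iff one_lt_two (by positivity),
          div_le_one (by linarith)] at hi
        have : (n : ℝ) ≤ α + 1 := by linarith
        exact_mod_cast this
      have hempty : {ω | (khat ω : ℤ) ∉ Set.Icc ((kstar : ℤ) - α) ((kstar : ℤ) + α)} = ∅ := by
        ext ω
        obtain ⟨h1, h2⟩ := Finset.mem_Icc.1 (hrun.estimate ω).1
        obtain ⟨h3, h4⟩ := hk
        simp only [Set.mem_ofPred_eq, Set.mem_empty_iff_false, iff_false, not_not]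
        constructor <;> omega
      rw [hempty, MeasureTheory.measureReal_empty]
      positivity
    · refine herr.trans (mul_le_mul_of_nonneg_left (hexp.trans ?_) zero_le_two)
      -- Only the term `i = 1` of the sum is used.
      refine le_trans ?_ (Finset.single_le_sum (fun i _ => (Real.exp_pos _).le)
        (Finset.mem_Icc.2 ⟨le_rfl, hi⟩))
      apply Real.exp_le_exp.2
      have := mul_le_mul_of_nonneg_left hIs (by linarith : (0 : ℝ) ≤ α)
      rw [Nat.sub_self, pow_zero, one_mul, mul_div_assoc]
      linarith
  · refine herr.trans (mul_le_mul_of_nonneg_left (hexp.trans ?_) zero_le_two)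
    have hcB : 1 - BMCPD.cB ε P₀ P₁ / 2 =
        1 - (Real.tanh (ε / 2) * BMCPD.dTV P₀ P₁) ^ 2 := by
      rw [BMCPD.cB]
      ring
    have hx0 := mul_nonneg (BMCPD.tanh_half_pos hε).le (BMCPD.dTV_nonneg P₀ P₁)
    have hx1 := BMCPD.tanh_mul_dTV_lt_one hε hP₀ hP₁
    rw [hcB, Real.rpow_def_of_pos (by nlinarith)]
    apply Real.exp_le_exp.2
    have := mul_le_mul_of_nonneg_left hIc (by linarith : (0 : ℝ) ≤ α)
    linarith
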